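/- **Setting.** Let $n,m\ge 1$ be integers. For $K\subset\mathbb R^{n\times n}$ put $R_0(K)=K$ and, for $l\ge1$, $R_l(K)=\{\lambda A+(1-\lambda)B:\ \lambda\in(0,1),\ A,B\in R_{l-1}(K),\ \operatorname{rank}(A-B)=1\}$, and let $K^{lc}=\bigcup_{l\ge0}R_l(K)$. Fix $V\subset\mathbb R^{n\times n}$ with $K^{lc}\subset V$ (for instance $V=\mathbb R^{n\times n}$ or the set of trace-free matrices); $\operatorname{int}(K^{lc})$ and "open" for sets of matrices are understood relative to $V$. Sets $S_0,S_1,\dots$ form an *in-approximation of $K$* if every $S_i$ is open, $S_i\subset S_{i+1}^{lc}$, and $W_i\in S_i$ (for all large $i$), $W_i\to W$ imply $W\in K$. Let $\operatorname{Per}$ be the De Giorgi perimeter in $\mathbb R^n$, $|\cdot|$ Lebesgue measure on sets, and let $\mathcal C$ be a class of bounded open subsets of $\mathbb R^n$ of finite perimeter. Let $G\subset\mathbb R^{n\times n}$ carry the structure of a topological group acting continuously on $K^{lc}$. Assume, with constants $v_1,c_2\in(0,1)$, $C_1,C_2\ge1$, $C_3>1$ and $C_0(j,k)\ge1$: * **(A1)**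 There are $M_1,\dots,M_m\in K$ with $K=\bigcup_{l=1}^m GM_l$, a disjoint union, and $c_1>0$ with $\operatorname{dist}(GM_i,GM_j)\ge c_1$ for $i\ne j$; moreover $\operatorname{int}(K^{lc})\neq\emptyset$. * **(A2)** There are sets $\tilde U_k^j,U_k^j\subset\operatorname{int}(K^{lc})$, $k\in\mathbb N$, $0\le j\le m$, with $\tilde U_k^j=G\tilde U_k^j$, $U_k^j=GU_k^j$, $\operatorname{int}(K^{lc})=\bigcup_{k,j}\tilde U_k^j$, $\tilde U_k^m=U_k^m=U_{k+1}^0$, such that for every $k$ the sequence $\tilde U_k^0,\dots,\tilde U_k^m=U_{k+1}^0,U_{k+1}^1,\dots,U_{k+1}^m=U_{k+2}^0,U_{k+2}^1,\dots$ is an in-approximation of $K$, and for every $j$, $\sup\{\operatorname{dist}(M,K):M\in U_k^j\}\to0$ as $k\to\infty$. * **Replacement constructions.** A *replacement construction* on $D\in\mathcal C$ for a matrix $M$ with target $T\subset\mathbb R^{n\times n}$ consists of a continuous $u:\overline D\to\mathbb R^n$, finitely many pairwise disjoint pieces $D_1,\dots,D_N\in\mathcal C$ contained in $D$ and covering $D$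 up to a null set, on each of which $u$ is affine, and a set $D_g$ that is a union of some of the pieces (the *good* pieces; the others are *bad*), such that $u(x)=Mx$ on $\partial D$ and on all bad pieces, $\nabla u\in T$ on $D_g$, $|D_g|\ge v_1|D|$, and $|\nabla u|\le C_3$ on all pieces. * **($\tilde{\text{A3}}$)** For all $k$, $0\le j<m$, $M\in\tilde U_k^j$ there is a special subclass $\mathcal C^1=\mathcal C^1(k,j,M)\subset\mathcal C$ such that each $D\in\mathcal C$ admits a replacement construction for $M$ with target $\tilde U_k^{j+1}$ with the following properties. (i) The perimeters of the good pieces sum to at most $C_0(j,k)\operatorname{Per}(D)$. (ii) If $D\in\mathcal C^1$, all bad pieces lie in $\mathcal C^1$ and their perimeters sum to at most $C_2\operatorname{Per}(D)$. (iii) If $D\notin\mathcal C^1$, the bad pieces split into two groups: those of the first lie in $\mathcal C^1$ and have total perimeter at most $C_0(j,k)\operatorname{Per}(D)$, those of the second have total perimeter at most $C_2\operatorname{Per}(D)$. * **(A3), (A4)** For all $k$, $0\le j<m$, $M\in U_k^j$ and $D\in\mathcal C$ there is a replacement construction for $M$ with target $U_k^{j+1}$ whose pieces have total perimeter at most $C_1\operatorname{Per}(D)$,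 and a set $D_g^\star\subset D_g$ with $|D_g^\star|\ge(1-C_3c_2^k)|D_g|$ and $|\nabla u-M|\le C_3c_2^k$ on $D_g^\star$. For $\Omega\in\mathcal C$ and a map $u$ with weak gradient $\nabla u$ define, for $1\le j<m$, $\chi_u^{(j)}(x)=1$ if $x\in\Omega$ and $\operatorname{dist}(\nabla u(x),GM_j)<\operatorname{dist}(\nabla u(x),\bigcup_{i\ne j}GM_i)$, and $\chi_u^{(j)}(x)=0$ otherwise; and $\chi_u^{(m)}=1-\sum_{j<m}\chi_u^{(j)}$. **Proposition.** There is $\theta_0\in(0,1)$, depending only on $n$, $m$ and the constants $v_1,c_2,C_1,C_2$ (in particular not on $\Omega\in\mathcal C$, on $M_0$, or on $C_0(j,k),C_3$), such that whenever the assumptions above hold: for every $\Omega\in\mathcal C$, all $s\in(0,1)$ and $p\in(1,\infty)$ with $0<sp<\theta_0$, and every $M_0\in\operatorname{int}(K^{lc})$, there is a solution $u\in W^{1,\infty}_{loc}(\mathbb R^n;\mathbb R^n)$ (hence $u\in W^{1,\infty}(\Omega)$) of $$\nabla u\in K\ \text{ a.e. in }\Omega,\qquad \nabla u=M_0\ \text{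 a.e. in }\mathbb R^n\setminus\Omega,$$ with $\chi_u^{(1)},\dots,\chi_u^{(m)}\in W^{s,p}(\Omega)$. -/

import Mathlib

open MeasureTheory Filter Topology Set
open scoped ENNReal

noncomputable section

namespace CvxInt

/-- The space `ℝⁿ` with its Euclidean norm. -/
abbrev E (n : ℕ) : Type := EuclideanSpace ℝ (Fin n)

/-- The space `ℝⁿˣⁿ` of real `n × n` matrices, as linear maps `ℝⁿ → ℝⁿ`.
It carries the operator norm; all norms on it are equivalent. -/
abbrev Mat (n : ℕ) : Type := E n →L[ℝ] E n

variable {n m : ℕ}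

/-! ### Lamination convexity -/

/-- `laminates K l` is the set `R_l(K)` of laminates of order at most `l`. -/
def laminates (K : Set (Mat n)) : ℕ → Set (Mat n)
  | 0 => K
  | l + 1 => {M | ∃ A ∈ laminates K l, ∃ B ∈ laminates K l, ∃ t : ℝ, 0 < t ∧ t < 1 ∧
      Module.finrank ℝ (LinearMap.range (A - B).toLinearMap) = 1 ∧
      M = t • A + (1 - t) • B}

/-- The lamination convex hull `K^{lc}`. -/
def laminationHull (K : Set (Mat n)) : Set (Mat n) := ⋃ l, laminates K l

/-- The interior of `S` relative to the set `V` of admissible matrices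
(the usual interior if `V = univ`). -/
def relInterior (V S : Set (Mat n)) : Set (Mat n) := {M | M ∈ V ∧ M ∈ S ∧ S ∈ 𝓝[V] M}

/-- In-approximation of `K` by (relatively) open sets `S 0, S 1, …`. In the closing condition
finitely many members of the sequence `W` are disregarded, which makes no difference when the sets
are nonempty. -/
structure IsInApproximation (V K : Set (Mat n)) (S : ℕ → Set (Mat n)) : Prop where
  isOpen : ∀ i, ∃ O : Set (Mat n), IsOpen O ∧ S i = O ∩ V
  subset_hull : ∀ i, S i ⊆ laminationHull (S (i + 1))
  limit_mem : ∀ (W : ℕ → Mat n) (L : Mat n), (∀ᶠ i in atTop, W i ∈ S i) →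
    Tendsto W atTop (𝓝 L) → L ∈ K

/-! ### The group action -/

/-- The set `G S = {g A : g ∈ G, A ∈ S}` for a group `G` acting on `K^{lc}` and `S ⊆ K^{lc}`. -/
def groupOrbit (K G : Set (Mat n)) [Group G] [MulAction G (laminationHull K)]
    (S : Set (Mat n)) : Set (Mat n) :=
  {N | ∃ (g : G) (A : laminationHull K), (A : Mat n) ∈ S ∧ ((g • A : laminationHull K) : Mat n) = N}

/-- The orbits of `M₁, …, Mₘ ∈ K` are pairwise disjoint with union `K`, they have positive mutual
distance, and `K^{lc}` has nonempty (relative) interior. -/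
structure AssumptionA1 (V K G : Set (Mat n)) [Group G] [MulAction G (laminationHull K)]
    (Mw : Fin m → Mat n) : Prop where
  mem : ∀ l, Mw l ∈ K
  union : K = ⋃ l, groupOrbit K G {Mw l}
  disjoint : ∀ i j, i ≠ j → Disjoint (groupOrbit K G {Mw i}) (groupOrbit K G {Mw j})
  separated : ∃ c₁ : ℝ, 0 < c₁ ∧ ∀ i j, i ≠ j →
    ∀ A ∈ groupOrbit K G {Mw i}, ∀ B ∈ groupOrbit K G {Mw j}, c₁ ≤ dist A B
  hull_subset : laminationHull K ⊆ V
  nonempty : (relInterior V (laminationHull K)).Nonempty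

/-- The sequence `Ũ_k^0, …, Ũ_k^m = U_{k+1}^0, U_{k+1}^1, …, U_{k+1}^m = U_{k+2}^0, …`. -/
def stageSeq (m : ℕ) (Ut U : ℕ → ℕ → Set (Mat n)) (k i : ℕ) : Set (Mat n) :=
  if i < m then Ut k i else U (k + i / m) (i % m)

/-- The sets `Ũ_k^j = Ut k j` and `U_k^j = U k j`, for `k ∈ ℕ` and `0 ≤ j ≤ m`. -/
structure AssumptionA2 (m : ℕ) (V K G : Set (Mat n)) [Group G] [MulAction G (laminationHull K)]
    (Ut U : ℕ → ℕ → Set (Mat n)) : Prop where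
  Ut_subset : ∀ k, ∀ j ≤ m, Ut k j ⊆ relInterior V (laminationHull K)
  U_subset : ∀ k, ∀ j ≤ m, U k j ⊆ relInterior V (laminationHull K)
  Ut_invariant : ∀ k, ∀ j ≤ m, Ut k j = groupOrbit K G (Ut k j)
  U_invariant : ∀ k, ∀ j ≤ m, U k j = groupOrbit K G (U k j)
  cover : relInterior V (laminationHull K) = ⋃ k, ⋃ j ∈ Iic m, Ut k j
  Ut_last : ∀ k, Ut k m = U k m
  U_last : ∀ k, U k m = U (k + 1) 0
  inApprox : ∀ k, IsInApproximation V K (stageSeq m Ut U k)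
  dist_tendsto : ∀ j ≤ m,
    Tendsto (fun k => ⨆ M ∈ U k j, Metric.infEDist M K) atTop (𝓝 0)

/-! ### Perimeter and classes of domains -/

/-- Divergence of a vector field. -/
def divergence (φ : E n → E n) (x : E n) : ℝ :=
  ∑ i, (fderiv ℝ φ x (EuclideanSpace.single i 1)) i

/-- The (De Giorgi) perimeter of a measurable set in `ℝⁿ`. -/
def perimeter (S : Set (E n)) : ℝ≥0∞ :=
  ⨆ (φ : E n → E n) (_ : ContDiff ℝ 1 φ) (_ : HasCompactSupport φ) (_ : ∀ x, ‖φ x‖ ≤ 1),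
    ENNReal.ofReal (∫ x in S, divergence φ x)

/-- A class of bounded open sets of finite perimeter. -/
structure IsDomainClass (𝒞 : Set (Set (E n))) : Prop where
  isOpen : ∀ D ∈ 𝒞, IsOpen D
  isBounded : ∀ D ∈ 𝒞, Bornology.IsBounded D
  perimeter_lt_top : ∀ D ∈ 𝒞, perimeter D < ⊤

/-! ### Replacement constructions -/

/-- A replacement construction on the domain `D` for the matrix `M` with target set `T`: a
continuous, piecewise affine `u : closure D → ℝⁿ` with finitely many pieces `P i ∈ 𝒞`, on which
`∇u` is the constant `A i`, such that `u(x) = M x` on `∂D` and on all pieces outside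
`D_g = ⋃ i ∈ g, P i`, while `∇u ∈ T` in `D_g` and `|D_g| ≥ v₁ |D|`. The gradient is bounded by
`C₃`. -/
structure Replacement (𝒞 : Set (Set (E n))) (v₁ C₃ : ℝ) (D : Set (E n)) (M : Mat n)
    (T : Set (Mat n)) where
  /-- the function -/
  u : E n → E n
  /-- the number of pieces -/
  N : ℕ
  /-- the pieces -/
  P : Fin N → Set (E n)
  /-- the values of the gradient -/
  A : Fin N → Mat n
  /-- the indices of the pieces that form `D_g` -/
  g : Finset (Fin N)
  mem_class : ∀ i, P i ∈ 𝒞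
  subset : ∀ i, P i ⊆ D
  disjoint : ∀ i j, i ≠ j → Disjoint (P i) (P j)
  cover : volume (D \ ⋃ i, P i) = 0
  continuousOn : ContinuousOn u (closure D)
  affine : ∀ i, ∃ b : E n, ∀ x ∈ P i, u x = A i x + b
  boundary : ∀ x ∈ frontier D, u x = M x
  unchanged : ∀ i ∉ g, ∀ x ∈ P i, u x = M x
  target : ∀ i ∈ g, A i ∈ T
  volume_good : ENNReal.ofReal v₁ * volume D ≤ volume (⋃ i ∈ g, P i)
  bounded : ∀ i, ‖A i‖ ≤ C₃

/-- Replacement constructions for `Ũ_k^j`, with the gradient bound `C₃`. The special class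
`𝒞₁ k j M` is allowed to depend on the matrix `M ∈ Ũ_k^j` that is being replaced. -/
structure AssumptionA3t (m : ℕ) (Ut : ℕ → ℕ → Set (Mat n)) (𝒞 : Set (Set (E n)))
    (𝒞₁ : ℕ → ℕ → Mat n → Set (Set (E n))) (v₁ C₂ C₃ : ℝ) (C₀ : ℕ → ℕ → ℝ) : Prop where
  one_le : ∀ k j, 1 ≤ C₀ k j
  subset : ∀ k j M, 𝒞₁ k j M ⊆ 𝒞
  construction : ∀ k, ∀ j < m, ∀ D ∈ 𝒞, ∀ M ∈ Ut k j,
    ∃ R : Replacement 𝒞 v₁ C₃ D M (Ut k (j + 1)),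
      (∑ i ∈ R.g, perimeter (R.P i) ≤ ENNReal.ofReal (C₀ k j) * perimeter D) ∧
      (D ∈ 𝒞₁ k j M →
        (∀ i ∉ R.g, R.P i ∈ 𝒞₁ k j M) ∧
        ∑ i ∈ R.gᶜ, perimeter (R.P i) ≤ ENNReal.ofReal C₂ * perimeter D) ∧
      (D ∉ 𝒞₁ k j M →
        ∃ I₁ I₂ : Finset (Fin R.N), Disjoint I₁ I₂ ∧ I₁ ∪ I₂ = R.gᶜ ∧
          (∀ i ∈ I₁, R.P i ∈ 𝒞₁ k j M) ∧
          ∑ i ∈ I₁, perimeter (R.P i) ≤ ENNReal.ofReal (C₀ k j) * perimeter D ∧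
          ∑ i ∈ I₂, perimeter (R.P i) ≤ ENNReal.ofReal C₂ * perimeter D)

/-- Replacement constructions for `U_k^j` with uniform perimeter bound `C₁`, whose gradients are
bounded by `C₃` and, on a set `D_g^⋆ ⊆ D_g` of nearly full measure, are exponentially close
to `M`. -/
def AssumptionA3A4 (m : ℕ) (U : ℕ → ℕ → Set (Mat n)) (𝒞 : Set (Set (E n)))
    (v₁ C₁ c₂ C₃ : ℝ) : Prop :=
  ∀ k, ∀ j < m, ∀ D ∈ 𝒞, ∀ M ∈ U k j,
    ∃ R : Replacement 𝒞 v₁ C₃ D M (U k (j + 1)),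
      (∑ i, perimeter (R.P i) ≤ ENNReal.ofReal C₁ * perimeter D) ∧
      ∃ Dstar ⊆ ⋃ i ∈ R.g, R.P i,
        ENNReal.ofReal (1 - C₃ * c₂ ^ k) * volume (⋃ i ∈ R.g, R.P i) ≤ volume Dstar ∧
        ∀ i, ∀ x ∈ Dstar ∩ R.P i, ‖R.A i - M‖ ≤ C₃ * c₂ ^ k

/-! ### Sobolev spaces, solutions and characteristic functions -/

/-- `u ∈ W^{1,∞}_loc(ℝⁿ; ℝⁿ)` with weak gradient `Du`. -/
structure HasWeakGradientW1InftyLoc (u : E n → E n) (Du : E n → Mat n) : Prop where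
  memLp : ∀ Q : Set (E n), IsCompact Q → MemLp u ⊤ (volume.restrict Q)
  memLp_grad : ∀ Q : Set (E n), IsCompact Q → MemLp Du ⊤ (volume.restrict Q)
  weak : ∀ φ : E n → ℝ, ContDiff ℝ (⊤ : ℕ∞) φ → HasCompactSupport φ → ∀ v : E n,
    ∫ x, (fderiv ℝ φ x v) • u x = - ∫ x, φ x • Du x v

/-- `f ∈ W^{s,p}(Ω)` for `0 < s < 1`, `1 < p < ∞` (Gagliardo–Slobodeckij). -/
def MemFracSobolev (s p : ℝ) (Ω : Set (E n)) (f : E n → ℝ) : Prop :=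
  MemLp f (ENNReal.ofReal p) (volume.restrict Ω) ∧
    ∫⁻ x in Ω, ∫⁻ y in Ω, ENNReal.ofReal (|f x - f y| ^ p / ‖x - y‖ ^ ((n : ℝ) + s * p)) < ⊤

open Classical in
/-- The indicator function of the points of `Ω` at which `Du` is strictly closer to the orbit of
`M_j` than to the union of the other orbits. -/
def phaseIndicator (K G : Set (Mat n)) [Group G] [MulAction G (laminationHull K)]
    (Mw : Fin m → Mat n) (Ω : Set (E n)) (Du : E n → Mat n) (j : Fin m) (x : E n) : ℝ :=
  if x ∈ Ω ∧ Metric.infEDist (Du x) (groupOrbit K G {Mw j}) <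
      Metric.infEDist (Du x) (⋃ i ∈ {i | i ≠ j}, groupOrbit K G {Mw i})
  then 1 else 0

/-- The characteristic functions `χ_u^{(1)}, …, χ_u^{(m)}`, indexed by `Fin m`; the last one is
`1` minus the sum of the others. -/
def phaseChar (K G : Set (Mat n)) [Group G] [MulAction G (laminationHull K)]
    (Mw : Fin m → Mat n) (Ω : Set (E n)) (Du : E n → Mat n) (j : Fin m) (x : E n) : ℝ :=
  if (j : ℕ) + 1 < m then phaseIndicator K G Mw Ω Du j x
  else 1 - ∑ i ∈ Finset.univ.filter (fun i : Fin m => (i : ℕ) + 1 < m),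
    phaseIndicator K G Mw Ω Du i x

end CvxInt

end

noncomputable section
namespace CvxInt
variable {n m : ℕ}

/-! Start from the affine map `M₀` on `Ω`, whose matrix lies in some `Ũ_k^j`, and repeatedly insert
a replacement construction into every piece of the current map. A good piece moves one set further
along the in-approximation attached to `k` (its depth `d` grows by one), while a bad piece keeps its
matrix and its depth.

Put `q = c₂^(1/m)`. Good pieces fill at least the fraction `v₁` of each piece, so the sum of `q^d
|P|` over all pieces contracts by `ρ = 1 - v₁ (1 - q)` per step (`Replacement.depthVolume_le`). By
(A4) the `L¹` change of the gradient in a step is at most a constant times this sum, so the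
gradients converge geometrically, and by Poincaré's inequality so do the maps. The sums are
summable, hence at almost every point of `Ω` the depth tends to infinity. It grows by at most one at
a time, so it takes every large value, and the closing condition of the in-approximation puts the
limit gradient in `K` (`ae_limit_mem`).

Perimeters grow at most by `Λ = max C₁ (C₂ + 2)` per step, once they are weighted suitably. The
large factors `C₀(j,k)` occur only at depths below `m`, and only when a piece goes deeper or enters
the special class. Each piece can do this boundedly often, and `stepWeight` drops by a power of `a ≥
C₀(j,k)` each time to pay for it (`sum_stepWeight_le`). Thus `C₀`, `C₃`, `M₀` and `Ω` affect
constants but neither rate.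

The phase functions are functions of the gradient. They are discontinuous, but the separation of the
orbits gives a Lipschitz estimate when one of the two matrices is in `K`. So they are approximated
in `L¹` with error `ρ^i` by piecewise constant functions of variation `Λ^i`, up to constants. A
translation by `h` then costs `ρ^i + |h| Λ^i` in `L¹`. The best `i` gives `|h|^θ` with `θ = log ρ /
(log ρ - log Λ)`, and for bounded functions this is enough for `W^{s,p}` as soon as `s p < θ`
(`memFracSobolev_of_approx`). -/

/-! ### Continuous selections of finitely many affine maps -/

/-- A function on an interval that is Lipschitz on each member of a finite closed cover is
Lipschitz. -/
lemma dist_le_of_finite_closed_cover {ι F : Type*} [PseudoMetricSpace F] (f : ℝ → F) (L : ℝ)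
    (C : ι → Set ℝ) (hC : ∀ i, IsClosed (C i))
    (hf : ∀ i, ∀ x ∈ C i, ∀ y ∈ C i, dist (f x) (f y) ≤ L * |x - y|) (s : Finset ι) :
    ∀ a b : ℝ, a ≤ b → Icc a b ⊆ ⋃ i ∈ s, C i → dist (f a) (f b) ≤ L * (b - a) := by
  classical
  induction s using Finset.strongInduction with
  | H s ih =>
    intro a b hab hcov
    obtain ⟨i, his, hai⟩ : ∃ i ∈ s, a ∈ C i := by
      simpa using hcov (left_mem_Icc.2 hab)
    have hT : IsCompact (C i ∩ Icc a b) := isCompact_Icc.inter_left (hC i)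
    have hTn : (C i ∩ Icc a b).Nonempty := ⟨a, hai, left_mem_Icc.2 hab⟩
    obtain ⟨c, ⟨hci, hac, hcb⟩, hc⟩ := hT.exists_isGreatest hTn
    have h1 : dist (f a) (f c) ≤ L * (c - a) := by
      have := hf i a hai c hci
      rwa [abs_sub_comm, abs_of_nonneg (sub_nonneg.2 hac)] at this
    rcases hcb.eq_or_lt with rfl | hlt
    · exact h1
    -- Beyond the last point `c` of `C i` the member `C i` is dispensable. At `c` itself the smaller
    -- cover is recovered by closedness, since `c` is a limit of points of `(c, b]`.
    have hcov' : Icc c b ⊆ ⋃ j ∈ s.erase i, C j := by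
      have hcl : IsClosed (⋃ j ∈ s.erase i, C j) :=
        Set.Finite.isClosed_biUnion (Finset.finite_toSet _) fun j _ => hC j
      rw [← closure_Ioc hlt.ne]
      refine closure_minimal (fun x hx => ?_) hcl
      obtain ⟨j, hj, hxj⟩ : ∃ j ∈ s, x ∈ C j := by
        simpa using hcov ⟨hac.trans hx.1.le, hx.2⟩
      refine mem_biUnion (Finset.mem_coe.2 (Finset.mem_erase.2 ⟨?_, hj⟩)) hxj
      rintro rfl
      exact absurd (hc ⟨hxj, hac.trans hx.1.le, hx.2⟩) (not_le.2 hx.1)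
    have h2 := ih _ (Finset.erase_ssubset his) c b hcb hcov'
    calc dist (f a) (f b) ≤ dist (f a) (f c) + dist (f c) (f b) := dist_triangle _ _ _
      _ ≤ L * (b - a) := by linarith

/-- A continuous selection of finitely many affine maps is Lipschitz. -/
lemma lipschitzWith_of_affine_selection {ι X Y : Type*} [Fintype ι] [NormedAddCommGroup X]
    [NormedSpace ℝ X] [NormedAddCommGroup Y] [NormedSpace ℝ Y] (u : X → Y) (hu : Continuous u)
    (A : ι → X →L[ℝ] Y) (b : ι → Y) (L : NNReal) (hA : ∀ i, ‖A i‖ ≤ L)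
    (hsel : ∀ x, ∃ i, u x = A i x + b i) : LipschitzWith L u := by
  refine LipschitzWith.of_dist_le_mul fun x y => ?_
  -- On a segment the coincidence sets with the individual affine maps form a finite closed cover,
  -- so the constant does not depend on how many maps there are.
  let γ : ℝ → X := fun t => x + t • (y - x)
  have hγ : Continuous γ := by fun_prop
  have key := dist_le_of_finite_closed_cover (u ∘ γ) (L * ‖y - x‖)
    (fun i => {t | u (γ t) = A i (γ t) + b i})
    (fun i => isClosed_eq (by fun_prop) (by fun_prop))
    (by
      intro i s hs t ht
      simp only [mem_ofPred_eq] at hs ht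
      have e : A i (γ s) + b i - (A i (γ t) + b i) = A i ((s - t) • (y - x)) := by
        rw [add_sub_add_right_eq_sub, ← map_sub]
        congr 1
        simp only [γ, sub_smul]; abel
      rw [Function.comp, Function.comp, dist_eq_norm, hs, ht, e]
      refine (ContinuousLinearMap.le_opNorm _ _).trans ?_
      rw [norm_smul, Real.norm_eq_abs]
      calc ‖A i‖ * (|s - t| * ‖y - x‖) ≤ L * (|s - t| * ‖y - x‖) := by
            gcongr; exact hA i
        _ = _ := by ring)
    Finset.univ 0 1 zero_le_one
    (by intro t _; simpa using hsel (γ t))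
  simpa [γ, dist_eq_norm, norm_sub_rev y x] using key

/-! ### Perimeter and translations -/

lemma divergence_smul_const (ψ : E n → ℝ) (hψ : ContDiff ℝ 1 ψ) (w x : E n) :
    divergence (fun y => ψ y • w) x = fderiv ℝ ψ x w := by
  have hd : DifferentiableAt ℝ ψ x := hψ.differentiable (by norm_num) x
  have hw : w = ∑ i, w i • EuclideanSpace.single i (1 : ℝ) := by
    ext j
    simp [Finset.sum_apply, Pi.single_apply]
  unfold divergence
  rw [fderiv_smul_const hd]
  conv_rhs => rw [hw]
  simp [mul_comm]

lemma integral_divergence_le (D : Set (E n)) (hD : perimeter D ≠ ⊤) (φ : E n → E n)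
    (h1 : ContDiff ℝ 1 φ) (h2 : HasCompactSupport φ) (h3 : ∀ x, ‖φ x‖ ≤ 1) :
    ∫ x in D, divergence φ x ≤ (perimeter D).toReal := by
  have : ENNReal.ofReal (∫ x in D, divergence φ x) ≤ perimeter D :=
    le_iSup_of_le φ (le_iSup_of_le h1 (le_iSup_of_le h2 (le_iSup_of_le h3 le_rfl)))
  exact (ENNReal.ofReal_le_iff_le_toReal hD).1 this

/-- The derivative of `∫_D ψ(x - t h)` in `t` is minus the integral over `D` of the divergence of
the field `ψ(· - t h) h`. After division by `‖h‖` this field competes in the supremum defining the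
perimeter; the mean value theorem picks one `t`. -/
lemma integral_sub_translate_le (D : Set (E n)) (hDv : volume D ≠ ⊤)
    (hD : perimeter D ≠ ⊤) (ψ : E n → ℝ) (h1 : ContDiff ℝ 1 ψ) (h2 : HasCompactSupport ψ)
    (h3 : ∀ x, |ψ x| ≤ 1) (h : E n) :
    (∫ x in D, ψ x) - ∫ x in D, ψ (x - h) ≤ ‖h‖ * (perimeter D).toReal := by
  rcases eq_or_ne h 0 with rfl | hh
  · simp
  have hh' : 0 < ‖h‖ := norm_pos_iff.2 hh
  have : IsFiniteMeasure (volume.restrict D) := ⟨by simpa using hDv.lt_top⟩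
  have hdc : Continuous (fderiv ℝ ψ) := h1.continuous_fderiv (by norm_num)
  obtain ⟨K, hK⟩ := hdc.bounded_above_of_compact_support (h2.fderiv (𝕜 := ℝ))
  let G : ℝ → E n → ℝ := fun t x => ψ (x - t • h)
  let G' : ℝ → E n → ℝ := fun t x => - fderiv ℝ ψ (x - t • h) h
  have hderiv : ∀ t : ℝ, HasDerivAt (fun t => ∫ x in D, G t x) (∫ x in D, G' t x) t := by
    intro t
    refine (hasDerivAt_integral_of_dominated_loc_of_deriv_le (μ := volume.restrict D)
      (F := G) (F' := G') (s := univ) (bound := fun _ => K * ‖h‖) univ_mem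
      ?_ ?_ ?_ ?_ (integrable_const _) ?_).2
    · exact Eventually.of_forall fun t =>
        (h1.continuous.comp (by fun_prop)).aestronglyMeasurable
    · refine Integrable.of_bound (h1.continuous.comp (by fun_prop)).aestronglyMeasurable 1 ?_
      exact Eventually.of_forall fun x => h3 _
    · refine Continuous.aestronglyMeasurable ?_
      exact ((hdc.comp (by fun_prop : Continuous fun x : E n => x - t • h)).clm_apply
        continuous_const).neg
    · refine Eventually.of_forall fun x t _ => ?_
      simp only [G', norm_neg]
      refine (ContinuousLinearMap.le_opNorm _ _).trans ?_
      gcongr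
      exact hK _
    · refine Eventually.of_forall fun x t _ => ?_
      have hd : HasFDerivAt ψ (fderiv ℝ ψ (x - t • h)) (x - t • h) :=
        (h1.differentiable (by norm_num) _).hasFDerivAt
      have hl : HasDerivAt (fun t : ℝ => x - t • h) (-h) t := by
        simpa using ((hasDerivAt_id t).smul_const h).const_sub x
      simpa [G, G', Function.comp_def] using hd.comp_hasDerivAt t hl
  obtain ⟨t, -, ht⟩ := exists_hasDerivAt_eq_slope (fun t => ∫ x in D, G t x)
    (fun t => ∫ x in D, G' t x) zero_lt_one
    (fun t _ => (hderiv t).continuousAt.continuousWithinAt) (fun t _ => hderiv t)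
  have e : (∫ x in D, ψ x) - ∫ x in D, ψ (x - h) = - ∫ x in D, G' t x := by
    rw [ht]; simp [G]
  let ψt : E n → ℝ := fun x => ψ (x - t • h)
  have hψt : ContDiff ℝ 1 ψt := h1.comp (by fun_prop)
  have hdt : ∀ x, fderiv ℝ ψt x = fderiv ℝ ψ (x - t • h) := fun x => by
    simp only [ψt]; rw [fderiv_comp_sub]
  let w : E n := ‖h‖⁻¹ • h
  have hw : ‖w‖ = 1 := by simp [w, norm_smul, hh'.ne']
  have hle := integral_divergence_le D hD (fun x => ψt x • w) (hψt.smul contDiff_const)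
    (by
      have : HasCompactSupport ψt := by
        simpa [ψt, sub_eq_add_neg, Function.comp_def] using
          h2.comp_homeomorph (Homeomorph.addRight (-(t • h)))
      exact this.smul_right)
    (fun x => by rw [norm_smul, hw, mul_one]; exact h3 _)
  have e2 : - ∫ x in D, G' t x = ‖h‖ * ∫ x in D, divergence (fun x => ψt x • w) x := by
    rw [← integral_neg, ← integral_const_mul]
    congr 1
    ext x
    rw [divergence_smul_const _ hψt, hdt]
    simp only [G', w, map_smul, smul_eq_mul, neg_neg]
    field_simp
  rw [e, e2]
  gcongr

open scoped Manifold ContDiff in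
/-- Smooth bump functions for compact sets. -/
lemma exists_contDiff_bump {K U : Set (E n)} (hK : IsCompact K) (hU : IsOpen U) (hKU : K ⊆ U) :
    ∃ ψ : E n → ℝ, ContDiff ℝ 1 ψ ∧ HasCompactSupport ψ ∧ (∀ x, 0 ≤ ψ x ∧ ψ x ≤ 1) ∧
      (∀ x ∈ K, ψ x = 1) ∧ ∀ x ∉ U, ψ x = 0 := by
  obtain ⟨R, hR⟩ := hK.isBounded.subset_ball 0
  obtain ⟨f, f1, f2, f3, f4⟩ := exists_contMDiff_support_eq_eq_one_iff (n := 1)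
    (modelWithCornersSelf ℝ (E n)) (hU.inter (Metric.isOpen_ball (x := (0 : E n)) (ε := R)))
    hK.isClosed (subset_inter hKU hR)
  refine ⟨f, contMDiff_iff_contDiff.1 f1, ?_, fun x => f2 (mem_range_self x),
    fun x hx => (f4 x).1 hx, fun x hx => ?_⟩
  · refine HasCompactSupport.intro (isCompact_closedBall (0 : E n) R) fun x hx => ?_
    rw [← Function.notMem_support, f3]
    exact fun h => hx (Metric.ball_subset_closedBall h.2)
  · rw [← Function.notMem_support, f3]
    exact fun h => hx h.1

/-- The volume of the points of `D` that leave `D` under translation by `h`. -/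
lemma volume_leave_le (D : Set (E n)) (hDm : MeasurableSet D) (hDv : volume D ≠ ⊤)
    (hD : perimeter D ≠ ⊤) (h : E n) :
    volume {x | x ∈ D ∧ x + h ∉ D} ≤ ENNReal.ofReal ‖h‖ * perimeter D := by
  set B : Set (E n) := {x | x ∈ D ∧ x + h ∉ D} with hB
  have hBm : MeasurableSet B :=
    hDm.inter ((measurable_add_const h) hDm).compl
  have hBv : volume B ≠ ⊤ := ne_top_of_le_ne_top hDv (measure_mono fun x hx => hx.1)
  rw [← ENNReal.ofReal_toReal hD, ← ENNReal.ofReal_mul (norm_nonneg _)]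
  refine ENNReal.le_of_forall_pos_le_add fun ε hε _ => ?_
  have hε2 : ((ε / 2 : NNReal) : ℝ≥0∞) ≠ 0 := by
    simpa using hε.ne'
  -- The difference of the indicators of `D` and `D - h` is `1` on `K ⊆ B` and at least `-1`
  -- everywhere. A bump `ψ` equal to `1` on `K` and supported in a slightly larger `U` therefore
  -- detects at least `|K| - |U \ K|`.
  obtain ⟨K, hKB, hK, hKv⟩ := hBm.exists_isCompact_lt_add hBv hε2
  obtain ⟨U, hKU, hU, hUv⟩ := hK.exists_isOpen_lt_add (μ := volume) hε2
  obtain ⟨ψ, p1, p2, p3, p4, p5⟩ := exists_contDiff_bump hK hU hKU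
  have hmain := integral_sub_translate_le D hDv hD ψ p1 p2
    (fun x => abs_le.2 ⟨by linarith [(p3 x).1], (p3 x).2⟩) h
  have hKfin : volume K ≠ ⊤ := hK.measure_lt_top.ne
  have hUfin : volume (U \ K) ≠ ⊤ :=
    ne_top_of_le_ne_top (ne_top_of_lt hUv) (measure_mono sdiff_subset)
  have hint : Integrable ψ volume := p1.continuous.integrable_of_hasCompactSupport p2
  have e1 : ∫ x in D, ψ (x - h) = ∫ x, ((fun y => y + h) ⁻¹' D).indicator ψ x := by
    rw [← integral_indicator hDm, ← integral_add_right_eq_self _ h]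
    congr 1
    ext x
    by_cases hx : x + h ∈ D <;> simp [indicator, hx]
  have hm2 : MeasurableSet ((fun y => y + h) ⁻¹' D) := (measurable_add_const h) hDm
  have e2 : (∫ x in D, ψ x) - ∫ x in D, ψ (x - h) =
      ∫ x, (D.indicator ψ x - ((fun y => y + h) ⁻¹' D).indicator ψ x) := by
    rw [e1, ← integral_indicator hDm, integral_sub (hint.indicator hDm) (hint.indicator hm2)]
  have hKm := hK.measurableSet
  have hlow : (volume K).toReal - (volume (U \ K)).toReal ≤
      ∫ x, (D.indicator ψ x - ((fun y => y + h) ⁻¹' D).indicator ψ x) := by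
    have e3 : (volume K).toReal - (volume (U \ K)).toReal =
        ∫ x, (K.indicator (fun _ => (1 : ℝ)) x - (U \ K).indicator (fun _ => (1 : ℝ)) x) := by
      rw [integral_sub, integral_indicator_const _ hKm,
        integral_indicator_const _ (hU.measurableSet.diff hKm)]
      · simp [Measure.real]
      · exact (integrable_indicator_iff hKm).2 (integrableOn_const hKfin)
      · exact (integrable_indicator_iff (hU.measurableSet.diff hKm)).2 (integrableOn_const hUfin)
    rw [e3]
    refine integral_mono ?_ ((hint.indicator hDm).sub (hint.indicator hm2)) fun x => ?_
    · exact ((integrable_indicator_iff hKm).2 (integrableOn_const hKfin)).sub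
        ((integrable_indicator_iff (hU.measurableSet.diff hKm)).2 (integrableOn_const hUfin))
    · by_cases hxK : x ∈ K
      · have hxB := hKB hxK
        simp [indicator, hxK, hxB.1, hxB.2, p4 x hxK]
      · have := p3 x
        by_cases hxU : x ∈ U
        · have hd : x ∈ U \ K := ⟨hxU, hxK⟩
          rw [indicator_of_notMem hxK, indicator_of_mem hd]
          have i1 : 0 ≤ D.indicator ψ x := indicator_nonneg (fun _ _ => (p3 _).1) _
          have i2 : ((fun y => y + h) ⁻¹' D).indicator ψ x ≤ ψ x :=
            indicator_le_self' (fun _ _ => this.1) _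
          linarith
        · simp [indicator, hxK, hxU, p5 x hxU]
  have hUK : volume (U \ K) ≤ (ε / 2 : NNReal) := by
    rw [measure_sdiff hKU hKm.nullMeasurableSet hKfin]
    exact tsub_le_iff_left.2 hUv.le
  have hUK' : (volume (U \ K)).toReal ≤ ε / 2 := by
    have := ENNReal.toReal_mono ENNReal.coe_ne_top hUK
    simpa using this
  have hfin : (volume K).toReal ≤ ‖h‖ * (perimeter D).toReal + ε / 2 := by
    rw [e2] at hmain
    linarith
  calc volume B ≤ volume K + (ε / 2 : NNReal) := hKv.le
    _ ≤ ENNReal.ofReal (‖h‖ * (perimeter D).toReal + ε / 2) + (ε / 2 : NNReal) := by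
        gcongr
        exact (ENNReal.le_ofReal_iff_toReal_le hKfin (by positivity)).2 hfin
    _ = ENNReal.ofReal (‖h‖ * (perimeter D).toReal) + ε := by
        rw [ENNReal.ofReal_add (by positivity) (by positivity), add_assoc]
        congr 1
        have : ENNReal.ofReal ((ε : ℝ) / 2) = ((ε / 2 : NNReal) : ℝ≥0∞) := by
          rw [← ENNReal.ofReal_coe_nnreal]; simp
        rw [this, ← ENNReal.coe_add, add_halves]

/-- Translations of characteristic functions of sets of finite perimeter. -/
lemma lintegral_indicator_translate_le (D : Set (E n)) (hDm : MeasurableSet D)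
    (hDv : volume D ≠ ⊤) (hD : perimeter D ≠ ⊤) (a : ℝ) (h : E n) :
    ∫⁻ x, ‖D.indicator (fun _ => a) (x + h) - D.indicator (fun _ => a) x‖ₑ ≤
      ‖a‖ₑ * (2 * ENNReal.ofReal ‖h‖ * perimeter D) := by
  have hm : MeasurableSet {x | x ∈ D ∧ x + h ∉ D} := hDm.inter ((measurable_add_const h) hDm).compl
  have hm' : MeasurableSet {x | x ∉ D ∧ x + h ∈ D} := hDm.compl.inter ((measurable_add_const h) hDm)
  have h1 := volume_leave_le D hDm hDv hD h
  have h2 : volume {x | x ∉ D ∧ x + h ∈ D} ≤ ENNReal.ofReal ‖h‖ * perimeter D := by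
    have := volume_leave_le D hDm hDv hD (-h)
    rw [norm_neg] at this
    refine le_trans (le_of_eq ?_) this
    rw [← measure_preimage_add_right volume h {x | x ∈ D ∧ x + -h ∉ D}]
    congr 1
    ext x
    simp [and_comm]
  calc ∫⁻ x, ‖D.indicator (fun _ => a) (x + h) - D.indicator (fun _ => a) x‖ₑ
      = ∫⁻ x, ({x | x ∈ D ∧ x + h ∉ D}.indicator (fun _ => ‖a‖ₑ) x +
          {x | x ∉ D ∧ x + h ∈ D}.indicator (fun _ => ‖a‖ₑ) x) := by
        refine lintegral_congr fun x => ?_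
        by_cases h1 : x ∈ D <;> by_cases h2 : x + h ∈ D <;> simp [indicator, h1, h2]
    _ = ‖a‖ₑ * volume {x | x ∈ D ∧ x + h ∉ D} + ‖a‖ₑ * volume {x | x ∉ D ∧ x + h ∈ D} := by
        rw [lintegral_add_left (measurable_const.indicator hm), lintegral_indicator_const hm,
          lintegral_indicator_const hm']
    _ ≤ ‖a‖ₑ * (ENNReal.ofReal ‖h‖ * perimeter D) + ‖a‖ₑ * (ENNReal.ofReal ‖h‖ * perimeter D) := by
        gcongr
    _ = _ := by ring

/-! ### Lipschitz functions and their gradients -/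

/-- `s` need not be open: it is also used for the complement of `Ω`, whose boundary may have
positive measure. On `s` the map is approximated by `M` with error constant `0`, which determines
the derivative almost everywhere on `s`. -/
lemma fderiv_ae_eq_of_eqOn_affine {L : NNReal} {u : E n → E n} (hu : LipschitzWith L u)
    {s : Set (E n)} (hs : MeasurableSet s) (M : Mat n) (b : E n) (h : ∀ x ∈ s, u x = M x + b) :
    ∀ᵐ x ∂(volume.restrict s), fderiv ℝ u x = M := by
  have hd : ∀ᵐ x ∂(volume : Measure (E n)), DifferentiableAt ℝ u x := hu.ae_differentiableAt
  have hdm : MeasurableSet {x | DifferentiableAt ℝ u x} := measurableSet_of_differentiableAt ℝ u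
  have hap : ApproximatesLinearOn u M (s ∩ {x | DifferentiableAt ℝ u x}) 0 := by
    intro x hx y hy
    simp [h x hx.1, h y hy.1]
  have key := hap.norm_fderiv_sub_le volume (hs.inter hdm) (fderiv ℝ u)
    (fun x hx => (hx.2 : DifferentiableAt ℝ u x).hasFDerivAt.hasFDerivWithinAt)
  rw [ae_restrict_iff' (hs.inter hdm)] at key
  rw [ae_restrict_iff' hs]
  filter_upwards [hd, key] with x hx1 hx2 hx3
  have := hx2 ⟨hx3, hx1⟩
  simpa [sub_eq_zero] using this

/-- Integration by parts for Lipschitz maps. -/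
lemma integral_fderiv_smul_eq {L : NNReal} {u : E n → E n} (hu : LipschitzWith L u)
    (φ : E n → ℝ) (h1 : ContDiff ℝ (⊤ : ℕ∞) φ) (h2 : HasCompactSupport φ) (v : E n) :
    ∫ x, (fderiv ℝ φ x v) • u x = - ∫ x, φ x • fderiv ℝ u x v := by
  have hφ1 : ContDiff ℝ 1 φ := h1.of_le (by exact_mod_cast le_top)
  obtain ⟨D, hD⟩ := hφ1.lipschitzWith_of_hasCompactSupport h2 (by norm_num)
  have hdφ : Continuous fun x => fderiv ℝ φ x v :=
    (hφ1.continuous_fderiv (by norm_num)).clm_apply continuous_const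
  have hi1 : Integrable (fun x => (fderiv ℝ φ x v) • u x) volume := by
    refine (hdφ.smul hu.continuous).integrable_of_hasCompactSupport ?_
    exact HasCompactSupport.smul_right (h2.fderiv_apply (𝕜 := ℝ) v)
  have hi2 : Integrable (fun x => φ x • fderiv ℝ u x v) volume := by
    refine Integrable.mono' (g := fun x => ‖φ x‖ * (L * ‖v‖))
      ((h1.continuous.integrable_of_hasCompactSupport h2).norm.mul_const _) ?_ ?_
    · exact (h1.continuous.measurable.smul
        (measurable_fderiv_apply_const ℝ u v)).aestronglyMeasurable
    · refine Eventually.of_forall fun x => ?_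
      rw [norm_smul]
      gcongr
      refine (ContinuousLinearMap.le_opNorm _ _).trans ?_
      gcongr
      exact norm_fderiv_le_of_lipschitz ℝ hu
  ext i
  have hp1 := (EuclideanSpace.proj (𝕜 := ℝ) i : E n →L[ℝ] ℝ).integral_comp_comm hi1
  have hp2 := (EuclideanSpace.proj (𝕜 := ℝ) i : E n →L[ℝ] ℝ).integral_comp_comm hi2
  simp only [PiLp.neg_apply]
  simp only [PiLp.proj_apply, PiLp.smul_apply, smul_eq_mul] at hp1 hp2
  rw [← hp1, ← hp2]
  have hui : LipschitzWith L fun x => u x i :=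
    LipschitzWith.of_dist_le_mul fun x y => by
      refine le_trans ?_ (hu.dist_le_mul x y)
      rw [dist_eq_norm, dist_eq_norm, ← PiLp.sub_apply]
      exact PiLp.norm_apply_le _ _
  have key := hui.integral_lineDeriv_mul_eq (μ := volume) hD h2 v
  have e1 : ∫ x, φ x * (fderiv ℝ u x v) i = ∫ x, lineDeriv ℝ (fun x => u x i) x v * φ x := by
    refine integral_congr_ae ?_
    have hae : ∀ᵐ x ∂(volume : Measure (E n)), DifferentiableAt ℝ u x := hu.ae_differentiableAt
    filter_upwards [hae] with x hx
    have := ((EuclideanSpace.proj (𝕜 := ℝ) i : E n →L[ℝ] ℝ).hasFDerivAt.comp x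
      hx.hasFDerivAt).hasLineDerivAt v
    have e : lineDeriv ℝ (fun x => u x i) x v = (fderiv ℝ u x v) i := this.lineDeriv
    rw [e, mul_comm]
  rw [e1, key, ← integral_neg]
  refine integral_congr_ae (Eventually.of_forall fun x => ?_)
  simp only
  rw [(hφ1.differentiable (by norm_num) x).lineDeriv_eq_fderiv]
  simp

/-- The difference quotients are compared by the reverse triangle inequality; this also covers
points where `w` vanishes and the norm has no chain rule. -/
lemma abs_lineDeriv_norm_le {w : E n → E n} {x v : E n} (hw : DifferentiableAt ℝ w x)
    (hg : LineDifferentiableAt ℝ (fun y => ‖w y‖) x v) :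
    |lineDeriv ℝ (fun y => ‖w y‖) x v| ≤ ‖fderiv ℝ w x v‖ := by
  have t1 := hg.hasLineDerivAt.tendsto_slope_zero.abs
  have t2 := (hw.hasFDerivAt.hasLineDerivAt v).tendsto_slope_zero.norm
  refine le_of_tendsto_of_tendsto t1 t2 (Eventually.of_forall fun t => ?_)
  simp only [smul_eq_mul, abs_mul, norm_smul, Real.norm_eq_abs]
  gcongr
  exact abs_norm_sub_norm_le _ _

/-- Poincaré's inequality in `W^{1,1}` for Lipschitz maps of compact support. -/
lemma lintegral_enorm_le_fderiv (hn : 0 < n) {L : NNReal} {w : E n → E n} (hw : LipschitzWith L w)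
    (R : ℝ) (hR : ∀ x, x ∉ Metric.closedBall (0 : E n) R → w x = 0) :
    ∫⁻ x, ‖w x‖ₑ ≤ ENNReal.ofReal R * ∫⁻ x, ‖fderiv ℝ w x‖ₑ := by
  let i : Fin n := ⟨0, hn⟩
  let e : E n := EuclideanSpace.single i 1
  have he : ‖e‖ = 1 := by simp [e]
  let f : E n → ℝ := fun x => x i
  let g : E n → ℝ := fun x => ‖w x‖
  have hf : LipschitzWith 1 f := LipschitzWith.of_dist_le_mul fun x y => by
    rw [dist_eq_norm, dist_eq_norm, NNReal.coe_one, one_mul]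
    exact PiLp.norm_apply_le (x - y) i
  have hg : LipschitzWith L g := LipschitzWith.of_dist_le_mul fun x y => by
    refine le_trans ?_ (hw.dist_le_mul x y)
    rw [dist_eq_norm, dist_eq_norm]
    exact abs_norm_sub_norm_le _ _
  have hwc : HasCompactSupport w := HasCompactSupport.intro (isCompact_closedBall (0 : E n) R) hR
  have hgc : HasCompactSupport g := hwc.norm
  have hwi : Integrable w volume := hw.continuous.integrable_of_hasCompactSupport hwc
  have hzero : ∀ x, x ∉ Metric.closedBall (0 : E n) R → fderiv ℝ w x = 0 := by
    intro x hx
    have : w =ᶠ[𝓝 x] fun _ => 0 := by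
      filter_upwards [Metric.isClosed_closedBall.isOpen_compl.mem_nhds hx] with y hy using hR y hy
    rw [this.fderiv_eq, fderiv_fun_const]; rfl
  have hdi : Integrable (fun x => ‖fderiv ℝ w x‖) volume := by
    have : IntegrableOn (fun x => ‖fderiv ℝ w x‖) (Metric.closedBall (0 : E n) R) volume := by
      refine Measure.integrableOn_of_bounded (M := L)
        (isCompact_closedBall _ _).measure_lt_top.ne
        (measurable_fderiv ℝ w).norm.aestronglyMeasurable (Eventually.of_forall fun x => ?_)
      rw [norm_norm]
      exact norm_fderiv_le_of_lipschitz ℝ hw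
    rwa [integrableOn_iff_integrable_of_support_subset] at this
    intro x hx
    by_contra h
    exact hx (by simp [hzero x h])
  -- Integrate `|w| = |w| ∂ᵢxᵢ` by parts. The derivative then falls on `|w|` and is multiplied by
  -- `xᵢ`, which is at most `R` in absolute value where `w` lives.
  have key := hf.integral_lineDeriv_mul_eq (μ := volume) hg hgc e
  have e1 : ∫ x, lineDeriv ℝ f x e * g x = ∫ x, ‖w x‖ := by
    refine integral_congr_ae (Eventually.of_forall fun x => ?_)
    have : lineDeriv ℝ f x e = 1 := by
      have := ((EuclideanSpace.proj (𝕜 := ℝ) i : E n →L[ℝ] ℝ).hasFDerivAt (x := x)).hasLineDerivAt e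
      have h2 : lineDeriv ℝ f x e = (EuclideanSpace.proj (𝕜 := ℝ) i : E n →L[ℝ] ℝ) e :=
        this.lineDeriv
      rw [h2]; simp [e]
    simp [this, g]
  have e2 : ∫ x, lineDeriv ℝ g x (-e) * f x ≤ ∫ x, R * ‖fderiv ℝ w x‖ := by
    refine (Real.le_norm_self _).trans (norm_integral_le_of_norm_le (hdi.const_mul R) ?_)
    have h1 : ∀ᵐ x ∂(volume : Measure (E n)), DifferentiableAt ℝ w x := hw.ae_differentiableAt
    have h2 : ∀ᵐ x ∂(volume : Measure (E n)), LineDifferentiableAt ℝ g x (-e) :=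
      hg.ae_lineDifferentiableAt _
    filter_upwards [h1, h2] with x hx1 hx2
    have h3 : |lineDeriv ℝ g x (-e)| ≤ ‖fderiv ℝ w x‖ := by
      refine (abs_lineDeriv_norm_le hx1 hx2).trans ?_
      refine (ContinuousLinearMap.le_opNorm _ _).trans ?_
      rw [norm_neg, he, mul_one]
    rw [norm_mul, Real.norm_eq_abs, mul_comm]
    by_cases hx : x ∈ Metric.closedBall (0 : E n) R
    · have h4 : ‖f x‖ ≤ R :=
        (PiLp.norm_apply_le x i).trans (mem_closedBall_zero_iff.1 hx)
      exact mul_le_mul h4 h3 (abs_nonneg _) ((norm_nonneg _).trans h4)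
    · rw [hzero x hx, norm_zero] at h3 ⊢
      rw [le_antisymm h3 (abs_nonneg _)]
      simp
  rw [← ofReal_integral_norm_eq_lintegral_enorm hwi]
  have e3 : ∫⁻ x, ‖fderiv ℝ w x‖ₑ = ENNReal.ofReal (∫ x, ‖fderiv ℝ w x‖) := by
    rw [ofReal_integral_eq_lintegral_ofReal hdi (Eventually.of_forall fun _ => norm_nonneg _)]
    simp only [ofReal_norm]
  rw [e3]
  rcases le_or_gt 0 R with hR0 | hR0
  · rw [← ENNReal.ofReal_mul hR0]
    refine ENNReal.ofReal_le_ofReal ?_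
    rw [← e1, key, ← integral_const_mul]
    exact e2
  · have : w = 0 := funext fun x => hR x (by simp [Metric.closedBall_eq_empty.2 hR0])
    simp [this]

/-- A sequence with geometrically decaying `L¹` increments converges almost everywhere and
in `L¹`. -/
lemma exists_limit_of_geometric {X F : Type*} [MeasurableSpace X] {μ : Measure X}
    [NormedAddCommGroup F] [CompleteSpace F] [SecondCountableTopology F] [MeasurableSpace F]
    [BorelSpace F] (f : ℕ → X → F)
    (hf : ∀ i, Measurable (f i)) (a r : ℝ≥0∞) (ha : a ≠ ⊤) (hr : r < 1)
    (h : ∀ i, ∫⁻ x, ‖f (i + 1) x - f i x‖ₑ ∂μ ≤ a * r ^ i) :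
    ∃ g : X → F, Measurable g ∧ (∀ᵐ x ∂μ, Tendsto (fun i => f i x) atTop (𝓝 (g x))) ∧
      ∀ i, ∫⁻ x, ‖f i x - g x‖ₑ ∂μ ≤ a * r ^ i * (1 - r)⁻¹ := by
  have hsum : ∀ i, ∫⁻ x, ∑' j, ‖f (i + j + 1) x - f (i + j) x‖ₑ ∂μ ≤ a * r ^ i * (1 - r)⁻¹ := by
    intro i
    have hm : ∀ j, AEMeasurable (fun x => ‖f (i + j + 1) x - f (i + j) x‖ₑ) μ :=
      fun j => ((hf _).sub (hf _)).enorm.aemeasurable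
    rw [lintegral_tsum hm]
    calc ∑' j, ∫⁻ x, ‖f (i + j + 1) x - f (i + j) x‖ₑ ∂μ ≤ ∑' j, a * r ^ i * r ^ j :=
          ENNReal.tsum_le_tsum fun j => by
            rw [mul_assoc, ← pow_add]; exact h (i + j)
      _ = a * r ^ i * (1 - r)⁻¹ := by rw [ENNReal.tsum_mul_left, ENNReal.tsum_geometric]
  have hfin : ∀ᵐ x ∂μ, ∑' j, ‖f (j + 1) x - f j x‖ₑ < ⊤ := by
    refine ae_lt_top (Measurable.tsum fun j => ((hf _).sub (hf _)).enorm) ?_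
    have := hsum 0
    simp only [zero_add] at this
    refine ne_top_of_le_ne_top ?_ this
    refine ENNReal.mul_ne_top (by simpa using ha) (ENNReal.inv_ne_top.2 ?_)
    exact (tsub_pos_of_lt hr).ne'
  have hlim : ∀ᵐ x ∂μ, ∃ l, Tendsto (fun i => f i x) atTop (𝓝 l) := by
    filter_upwards [hfin] with x hx
    refine cauchySeq_tendsto_of_complete (cauchySeq_of_edist_le_of_tsum_ne_top
      (fun j => ‖f (j + 1) x - f j x‖ₑ) (fun j => ?_) hx.ne)
    rw [edist_comm, edist_eq_enorm_sub]
  obtain ⟨g, hg, hlimg⟩ := measurable_limit_of_tendsto_metrizable_ae (μ := μ) (L := atTop)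
    (fun i => (hf i).aemeasurable) hlim
  refine ⟨g, hg, hlimg, fun i => le_trans (lintegral_mono_ae ?_) (hsum i)⟩
  filter_upwards [hlimg] with x hx
  rw [← edist_eq_enorm_sub]
  refine edist_le_tsum_of_edist_le_of_tendsto (fun j => ‖f (j + 1) x - f j x‖ₑ) (fun j => ?_) hx i
  rw [edist_comm, edist_eq_enorm_sub]

/-! ### Interpolation between `L¹` and `BV` -/

/-- Triangle inequality through `g`. Both `x` and `x + h` must stay in `Ω`, because `f` is close to
`g` only there. -/
lemma setLIntegral_translate_le {Ω : Set (E n)} (hΩ : MeasurableSet Ω) {f g : E n → ℝ}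
    (hf : Measurable f) (hg : Measurable g) {a b : ℝ≥0∞} (h : E n)
    (hfg : ∫⁻ x in Ω, ‖f x - g x‖ₑ ≤ a) (hgh : ∫⁻ x, ‖g (x + h) - g x‖ₑ ≤ b) :
    ∫⁻ x in Ω ∩ (fun y => y + h) ⁻¹' Ω, ‖f (x + h) - f x‖ₑ ≤ a + b + a := by
  have hm : MeasurableSet ((fun y => y + h) ⁻¹' Ω) := measurable_add_const h hΩ
  have hfm : Measurable fun x => ‖f x - g x‖ₑ := (hf.sub hg).enorm
  have hfm' : Measurable fun x => ‖f (x + h) - g (x + h)‖ₑ :=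
    hfm.comp (measurable_add_const h)
  have hgm : Measurable fun x => ‖g (x + h) - g x‖ₑ :=
    ((hg.comp (measurable_add_const h)).sub hg).enorm
  calc ∫⁻ x in Ω ∩ (fun y => y + h) ⁻¹' Ω, ‖f (x + h) - f x‖ₑ
      ≤ ∫⁻ x in Ω ∩ (fun y => y + h) ⁻¹' Ω,
          (‖f (x + h) - g (x + h)‖ₑ + ‖g (x + h) - g x‖ₑ + ‖f x - g x‖ₑ) := by
        refine lintegral_mono fun x => ?_
        have e : f (x + h) - f x =
            (f (x + h) - g (x + h)) + (g (x + h) - g x) + -(f x - g x) := by ring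
        calc ‖f (x + h) - f x‖ₑ = ‖(f (x + h) - g (x + h)) + (g (x + h) - g x) + -(f x - g x)‖ₑ := by
              rw [← e]
          _ ≤ _ := by
            refine (enorm_add_le _ _).trans ?_
            rw [enorm_neg]
            gcongr
            exact enorm_add_le _ _
    _ = (∫⁻ x in Ω ∩ (fun y => y + h) ⁻¹' Ω, ‖f (x + h) - g (x + h)‖ₑ) +
        (∫⁻ x in Ω ∩ (fun y => y + h) ⁻¹' Ω, ‖g (x + h) - g x‖ₑ) +
        ∫⁻ x in Ω ∩ (fun y => y + h) ⁻¹' Ω, ‖f x - g x‖ₑ := by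
        rw [lintegral_add_right _ hfm, lintegral_add_left hfm']
    _ ≤ a + b + a := by
        gcongr
        · calc ∫⁻ x in Ω ∩ (fun y => y + h) ⁻¹' Ω, ‖f (x + h) - g (x + h)‖ₑ
              ≤ ∫⁻ x in (fun y => y + h) ⁻¹' Ω, ‖f (x + h) - g (x + h)‖ₑ :=
                lintegral_mono_set inter_subset_right
            _ = ∫⁻ x, Ω.indicator (fun z => ‖f z - g z‖ₑ) (x + h) := by
                rw [← lintegral_indicator hm]; rfl
            _ = ∫⁻ x in Ω, ‖f x - g x‖ₑ := by
                rw [lintegral_add_right_eq_self (μ := volume)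
                  (Ω.indicator (fun z => ‖f z - g z‖ₑ)) h, lintegral_indicator hΩ]
            _ ≤ a := hfg
        · exact (setLIntegral_le_lintegral _ _).trans hgh
        · exact (lintegral_mono_set inter_subset_left).trans hfg

/-- Take `i` with `(ρ/Λ)^(i+1) < t ≤ (ρ/Λ)^i`, where `ρ^i` and `t Λ^i` balance. The exponent is the
solution of `(ρ/Λ)^θ = ρ`, and `ρ⁻¹` is the price of rounding to an integer. -/
lemma exists_pow_interpolation {ρ Λ t : ℝ} (hρ : 0 < ρ) (hρ1 : ρ < 1) (hΛ : 1 < Λ) (ht : 0 < t)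
    (ht1 : t ≤ 1) :
    ∃ i : ℕ, ρ ^ i ≤ ρ⁻¹ * t ^ (Real.log ρ / (Real.log ρ - Real.log Λ)) ∧
      t * Λ ^ i ≤ ρ⁻¹ * t ^ (Real.log ρ / (Real.log ρ - Real.log Λ)) := by
  have hΛ0 : 0 < Λ := zero_lt_one.trans hΛ
  set θ := Real.log ρ / (Real.log ρ - Real.log Λ) with hθ
  have hlρ : Real.log ρ < 0 := Real.log_neg hρ hρ1
  have hlΛ : 0 < Real.log Λ := Real.log_pos hΛ
  have hθ0 : 0 < θ := div_pos_of_neg_of_neg hlρ (by linarith)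
  have hq : (ρ / Λ) ^ θ = ρ := by
    rw [Real.rpow_def_of_pos (div_pos hρ hΛ0), Real.log_div hρ.ne' hΛ0.ne', hθ,
      mul_div_cancel₀ _ (by linarith : Real.log ρ - Real.log Λ ≠ 0), Real.exp_log hρ]
  obtain ⟨i, hi1, hi2⟩ := exists_nat_pow_near_of_lt_one ht ht1 (div_pos hρ hΛ0)
    ((div_lt_one hΛ0).2 (hρ1.trans hΛ))
  have h1 : ρ ^ i ≤ ρ⁻¹ * t ^ θ := by
    have : ρ ^ (i + 1) ≤ t ^ θ := by
      calc ρ ^ (i + 1) = ((ρ / Λ) ^ θ) ^ (i + 1) := by rw [hq]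
        _ = ((ρ / Λ) ^ (i + 1)) ^ θ := by
            rw [← Real.rpow_mul_natCast (div_pos hρ hΛ0).le, mul_comm,
              Real.rpow_natCast_mul (div_pos hρ hΛ0).le]
        _ ≤ t ^ θ := Real.rpow_le_rpow (by positivity) hi1.le hθ0.le
    rw [inv_mul_eq_div, le_div_iff₀ hρ, ← pow_succ]
    exact this
  refine ⟨i, h1, le_trans ?_ h1⟩
  calc t * Λ ^ i ≤ (ρ / Λ) ^ i * Λ ^ i := by gcongr
    _ = ρ ^ i := by rw [← mul_pow, div_mul_cancel₀ _ hΛ0.ne']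

lemma lintegral_ball_rpow_lt_top (hn : 0 < n) (c α R : ℝ) (hα : -(n : ℝ) < α) (hR : 0 < R) :
    ∫⁻ h in Metric.ball (0 : E n) R, ENNReal.ofReal (c * ‖h‖ ^ α) < ⊤ := by
  have : Nontrivial (E n) := by
    have : Nonempty (Fin n) := ⟨⟨0, hn⟩⟩
    infer_instance
  have hint : IntegrableOn (fun h : E n => c * ‖h‖ ^ α) (Metric.ball 0 R) volume := by
    refine Integrable.const_mul ?_ c
    refine (integrableOn_fun_norm_addHaar (μ := (volume : Measure (E n)))
      (f := fun y : ℝ => y ^ α)).2 ?_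
    have h1 : IntegrableOn (fun y : ℝ => y ^ ((n : ℝ) - 1 + α)) (Ioo 0 R) :=
      (intervalIntegral.integrableOn_Ioo_rpow_iff hR).2 (by linarith)
    refine h1.congr_fun (fun y hy => ?_) measurableSet_Ioo
    simp only [finrank_euclideanSpace, Fintype.card_fin, smul_eq_mul]
    rw [Real.rpow_add hy.1, ← Real.rpow_natCast, Nat.cast_sub hn, Nat.cast_one]
  refine lt_of_le_of_lt (lintegral_mono fun h => ?_) hint.2
  exact Real.ofReal_le_enorm _

/-- A bounded function that is approximated exponentially well in `L¹` by functions whose `BV` norm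
grows exponentially has fractional Sobolev regularity. -/
lemma memFracSobolev_of_approx (hn : 0 < n) {Ω : Set (E n)} (hΩ : MeasurableSet Ω)
    (hΩb : Bornology.IsBounded Ω) {f : E n → ℝ} (hf : Measurable f) {B : ℝ} (hB : ∀ x, |f x| ≤ B)
    {ρ Λ C : ℝ} (hρ : 0 < ρ) (hρ1 : ρ < 1) (hΛ : 1 < Λ) (hC : 0 ≤ C)
    (happ : ∀ i : ℕ, ∃ g : E n → ℝ, Measurable g ∧
      ∫⁻ x in Ω, ‖f x - g x‖ₑ ≤ ENNReal.ofReal (C * ρ ^ i) ∧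
      ∀ h, ∫⁻ x, ‖g (x + h) - g x‖ₑ ≤ ENNReal.ofReal (C * ‖h‖ * Λ ^ i))
    {s p : ℝ} (hs : 0 < s) (hp : 1 < p)
    (hsp : s * p < Real.log ρ / (Real.log ρ - Real.log Λ)) :
    MemFracSobolev s p Ω f := by
  set θ := Real.log ρ / (Real.log ρ - Real.log Λ) with hθ
  have hθ0 : 0 < θ := (by positivity : 0 < s * p).trans hsp
  have hB0 : 0 ≤ B := (abs_nonneg _).trans (hB 0)
  have hfin : IsFiniteMeasure (volume.restrict Ω) := ⟨by simpa using hΩb.measure_lt_top⟩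
  refine ⟨MemLp.of_bound hf.aestronglyMeasurable B (Eventually.of_forall hB), ?_⟩
  obtain ⟨r, hr⟩ := hΩb.subset_ball (0 : E n)
  set R : ℝ := 2 * max r 1 with hRdef
  have hR0 : 0 < R := by positivity
  -- The first summand serves `‖h‖ ≤ 1`, by interpolation; the other two serve `1 < ‖h‖ < R`, where
  -- the approximation with `i = 0` suffices.
  set C' : ℝ := 3 * C * ρ⁻¹ + 2 * C + C * R with hC'
  have hω : ∀ h : E n, h ≠ 0 → ‖h‖ < R →
      ∫⁻ x in Ω ∩ (fun y => y + h) ⁻¹' Ω, ‖f (x + h) - f x‖ₑ ≤ ENNReal.ofReal (C' * ‖h‖ ^ θ) := by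
    intro h hh hhR
    have hh0 : 0 < ‖h‖ := norm_pos_iff.2 hh
    have hi : ∀ i : ℕ, ∫⁻ x in Ω ∩ (fun y => y + h) ⁻¹' Ω, ‖f (x + h) - f x‖ₑ ≤
        ENNReal.ofReal (C * (2 * ρ ^ i + ‖h‖ * Λ ^ i)) := by
      intro i
      obtain ⟨g, hg, hg1, hg2⟩ := happ i
      refine (setLIntegral_translate_le hΩ hf hg h hg1 (hg2 h)).trans (le_of_eq ?_)
      rw [← ENNReal.ofReal_add (by positivity) (by positivity),
        ← ENNReal.ofReal_add (by positivity) (by positivity)]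
      congr 1; ring
    have hρi : 0 < ρ⁻¹ := by positivity
    have hpw : 0 < ‖h‖ ^ θ := Real.rpow_pos_of_pos hh0 _
    rcases le_or_gt ‖h‖ 1 with h1 | h1
    · obtain ⟨i, hi1, hi2⟩ := exists_pow_interpolation hρ hρ1 hΛ hh0 h1
      refine (hi i).trans (ENNReal.ofReal_le_ofReal ?_)
      calc C * (2 * ρ ^ i + ‖h‖ * Λ ^ i) ≤ C * (2 * (ρ⁻¹ * ‖h‖ ^ θ) + ρ⁻¹ * ‖h‖ ^ θ) := by gcongr
        _ = 3 * C * ρ⁻¹ * ‖h‖ ^ θ := by ring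
        _ ≤ C' * ‖h‖ ^ θ := by
            gcongr
            have : 0 ≤ C * R := by positivity
            linarith
    · refine (hi 0).trans (ENNReal.ofReal_le_ofReal ?_)
      have h2 : 1 ≤ ‖h‖ ^ θ := Real.one_le_rpow h1.le hθ0.le
      have h3 : C * (2 * ρ ^ 0 + ‖h‖ * Λ ^ 0) ≤ C' := by
        have : C * ‖h‖ ≤ C * R := by gcongr
        have : 0 ≤ C * ρ⁻¹ := by positivity
        simp only [pow_zero, mul_one]
        linarith
      have h4 : 0 ≤ C' := by positivity
      nlinarith
  have hsup : ∀ h : E n, ¬ ‖h‖ < R → Ω ∩ (fun y => y + h) ⁻¹' Ω = ∅ := by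
    intro h hh
    by_contra hne
    obtain ⟨x, hx, hxh⟩ := nonempty_iff_ne_empty.2 hne
    have h1 := mem_ball_zero_iff.1 (hr hx)
    have h2 := mem_ball_zero_iff.1 (hr hxh)
    refine hh ?_
    calc ‖h‖ = ‖(x + h) - x‖ := by simp
      _ ≤ ‖x + h‖ + ‖x‖ := norm_sub_le _ _
      _ < r + r := add_lt_add h2 h1
      _ ≤ R := by rw [hRdef]; linarith [le_max_left r 1]
  let c : ℝ := (2 * B) ^ (p - 1)
  have hc : 0 ≤ c := by positivity
  let k : E n → E n → ℝ≥0∞ := fun x h =>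
    ENNReal.ofReal (|f x - f (x + h)| ^ p / ‖h‖ ^ ((n : ℝ) + s * p))
  let H : E n → E n → ℝ≥0∞ := fun x h => Ω.indicator (fun _ => Ω.indicator (fun _ => k x h) (x + h)) x
  have hk : Measurable (Function.uncurry k) := by
    have h1 : Measurable fun z : E n × E n => f z.1 := hf.comp measurable_fst
    have h2 : Measurable fun z : E n × E n => f (z.1 + z.2) :=
      hf.comp (measurable_fst.add measurable_snd)
    have h3 : Measurable fun z : E n × E n => |f z.1 - f (z.1 + z.2)| := (h1.sub h2).norm
    exact ((h3.pow_const p).div (measurable_snd.norm.pow_const _)).ennreal_ofReal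
  have hH : Measurable (Function.uncurry H) := by
    have e : Function.uncurry H = ((Prod.fst ⁻¹' Ω) ∩ (fun z : E n × E n => z.1 + z.2) ⁻¹' Ω).indicator
        (Function.uncurry k) := by
      ext ⟨x, h⟩
      by_cases h1 : x ∈ Ω <;> by_cases h2 : x + h ∈ Ω <;> simp [H, indicator, h1, h2]
    rw [e]
    exact hk.indicator ((measurable_fst hΩ).inter ((measurable_fst.add measurable_snd) hΩ))
  -- Substituting `y = x + h` and exchanging the integrals makes the translation estimate applicable
  -- for each fixed `h`.
  have hstep1 : ∫⁻ x in Ω, ∫⁻ y in Ω,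
      ENNReal.ofReal (|f x - f y| ^ p / ‖x - y‖ ^ ((n : ℝ) + s * p)) = ∫⁻ x, ∫⁻ h, H x h := by
    rw [← lintegral_indicator hΩ]
    refine lintegral_congr fun x => ?_
    by_cases hx : x ∈ Ω
    · rw [indicator_of_mem hx, ← lintegral_indicator hΩ, ← lintegral_add_left_eq_self _ x]
      refine lintegral_congr fun h => ?_
      simp [H, hx, indicator, k]
    · simp [H, hx]
  have hswap : ∫⁻ x, ∫⁻ h, H x h = ∫⁻ h, ∫⁻ x, H x h :=
    lintegral_lintegral_swap hH.aemeasurable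
  rw [hstep1, hswap]
  have hbound : ∀ᵐ h ∂(volume : Measure (E n)), ∫⁻ x, H x h ≤
      (Metric.ball (0 : E n) R).indicator
        (fun h => ENNReal.ofReal (c * C' * ‖h‖ ^ (θ - (n + s * p)))) h := by
    have hne : ∀ᵐ h ∂(volume : Measure (E n)), h ≠ 0 := by
      have : Nontrivial (E n) := by
        have : Nonempty (Fin n) := ⟨⟨0, hn⟩⟩
        infer_instance
      exact Measure.ae_ne volume 0
    filter_upwards [hne] with h hh
    have hh0 : 0 < ‖h‖ := norm_pos_iff.2 hh
    have hmI : MeasurableSet (Ω ∩ (fun y => y + h) ⁻¹' Ω) :=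
      hΩ.inter (measurable_add_const h hΩ)
    have e : ∫⁻ x, H x h = ∫⁻ x in Ω ∩ (fun y => y + h) ⁻¹' Ω, k x h := by
      rw [← lintegral_indicator hmI]
      refine lintegral_congr fun x => ?_
      by_cases h1 : x ∈ Ω <;> by_cases h2 : x + h ∈ Ω <;> simp [H, indicator, h1, h2]
    rw [e]
    by_cases hhR : ‖h‖ < R
    · rw [indicator_of_mem (by simpa using hhR)]
      have hkb : ∀ x, k x h ≤ ENNReal.ofReal (c * (‖h‖ ^ ((n : ℝ) + s * p))⁻¹) *
          ‖f (x + h) - f x‖ₑ := by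
        intro x
        have hd : |f x - f (x + h)| ≤ 2 * B :=
          (abs_sub _ _).trans (by linarith [hB x, hB (x + h)])
        rw [← ofReal_norm, ← ENNReal.ofReal_mul (by positivity)]
        refine ENNReal.ofReal_le_ofReal ?_
        rw [div_eq_mul_inv, Real.norm_eq_abs, abs_sub_comm (f (x + h))]
        -- Boundedness reduces the `p`-th power to the first power, so an `L¹` modulus suffices and
        -- only the product `s p` matters.
        have : |f x - f (x + h)| ^ p ≤ c * |f x - f (x + h)| := by
          rcases (abs_nonneg (f x - f (x + h))).eq_or_lt with h0 | h0
          · rw [← h0, Real.zero_rpow (by linarith)]; simp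
          · calc |f x - f (x + h)| ^ p = |f x - f (x + h)| ^ (p - 1) * |f x - f (x + h)| := by
                  rw [← Real.rpow_add_one h0.ne']; congr 1; ring
              _ ≤ c * |f x - f (x + h)| := by
                  gcongr
                  exact Real.rpow_le_rpow h0.le hd (by linarith)
        calc |f x - f (x + h)| ^ p * (‖h‖ ^ ((n : ℝ) + s * p))⁻¹
            ≤ c * |f x - f (x + h)| * (‖h‖ ^ ((n : ℝ) + s * p))⁻¹ := by gcongr
          _ = _ := by ring
      calc ∫⁻ x in Ω ∩ (fun y => y + h) ⁻¹' Ω, k x h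
          ≤ ∫⁻ x in Ω ∩ (fun y => y + h) ⁻¹' Ω,
              ENNReal.ofReal (c * (‖h‖ ^ ((n : ℝ) + s * p))⁻¹) * ‖f (x + h) - f x‖ₑ :=
            lintegral_mono hkb
        _ = ENNReal.ofReal (c * (‖h‖ ^ ((n : ℝ) + s * p))⁻¹) *
              ∫⁻ x in Ω ∩ (fun y => y + h) ⁻¹' Ω, ‖f (x + h) - f x‖ₑ := by
            rw [lintegral_const_mul]
            exact ((hf.comp (measurable_add_const h)).sub hf).enorm
        _ ≤ ENNReal.ofReal (c * (‖h‖ ^ ((n : ℝ) + s * p))⁻¹) * ENNReal.ofReal (C' * ‖h‖ ^ θ) := by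
            gcongr
            exact hω h hh hhR
        _ = _ := by
            rw [← ENNReal.ofReal_mul (by positivity), Real.rpow_sub hh0]
            congr 1
            rw [div_eq_mul_inv]; ring
    · rw [hsup h hhR]; simp
  refine lt_of_le_of_lt (lintegral_mono_ae hbound) ?_
  rw [lintegral_indicator Metric.isOpen_ball.measurableSet]
  -- The exponent `θ - n - s p` exceeds `-n` exactly because `s p < θ`.
  exact lintegral_ball_rpow_lt_top hn _ _ _ (by linarith) hR0

/-! ### Stages of the convex integration scheme -/

/-- One step of the scheme: replacement constructions that move matrices from `S d` to `S (d + 1)`,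
for matrices of norm at most `L`, with control of a weighted perimeter and of the variation of the
gradient. -/
def StepRule (𝒞 : Set (Set (E n))) (S : ℕ → Set (Mat n)) (wt : ℕ → Mat n → Set (E n) → ℝ≥0∞)
    (v₁ C₃ q B Λ : ℝ) (L : NNReal) : Prop :=
  ∀ d, ∀ D ∈ 𝒞, ∀ M ∈ S d, ‖M‖ ≤ L → ∃ R : Replacement 𝒞 v₁ C₃ D M (S (d + 1)),
    (∑ i, (if i ∈ R.g then wt (d + 1) (R.A i) (R.P i) else wt d M (R.P i)) * perimeter (R.P i) ≤
      ENNReal.ofReal Λ * (wt d M D * perimeter D)) ∧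
    ∑ i ∈ R.g, ‖R.A i - M‖ₑ * volume (R.P i) ≤ ENNReal.ofReal (B * q ^ d) * volume D

/-- A continuous piecewise affine map with boundary values `M₀` on `Ω`, each of whose pieces has a
depth `d` such that the gradient on the piece lies in `S d`. -/
structure Stage (𝒞 : Set (Set (E n))) (S : ℕ → Set (Mat n)) (Ω : Set (E n)) (M₀ : Mat n)
    (L : NNReal) where
  /-- the index type of the pieces -/
  ι : Type
  fintype : Fintype ι
  /-- the map -/
  u : E n → E n
  /-- the pieces -/
  P : ι → Set (E n)
  /-- the gradient on the pieces -/
  A : ι → Mat n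
  /-- the translation part on the pieces -/
  b : ι → E n
  /-- the depth of the pieces -/
  d : ι → ℕ
  continuous : Continuous u
  mem_class : ∀ c, P c ∈ 𝒞
  subset : ∀ c, P c ⊆ Ω
  disjoint : ∀ c c', c ≠ c' → Disjoint (P c) (P c')
  cover : volume (Ω \ ⋃ c, P c) = 0
  affine : ∀ c, ∀ x ∈ P c, u x = A c x + b c
  outside : ∀ x ∉ Ω, u x = M₀ x
  mem : ∀ c, A c ∈ S (d c)
  bounded : ∀ c, ‖A c‖ ≤ L

attribute [instance] Stage.fintype

variable {𝒞 : Set (Set (E n))} {S : ℕ → Set (Mat n)} {Ω : Set (E n)} {M₀ : Mat n} {L : NNReal}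

lemma enorm_sub_self {F : Type*} [NormedAddCommGroup F] (a : F) : ‖a - a‖ₑ = 0 := by simp

namespace Stage

/-- The volume of the pieces, weighted exponentially by depth. -/
def depthVolume (s : Stage 𝒞 S Ω M₀ L) (q : ℝ) : ℝ≥0∞ :=
  ∑ c, ENNReal.ofReal (q ^ s.d c) * volume (s.P c)

/-- The weighted perimeter of the pieces. -/
def weightedPerimeter (s : Stage 𝒞 S Ω M₀ L) (wt : ℕ → Mat n → Set (E n) → ℝ≥0∞) : ℝ≥0∞ :=
  ∑ c, wt (s.d c) (s.A c) (s.P c) * perimeter (s.P c)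

/-- The uncovered part of `Ω` contains no nonempty open set, so the closures of the finitely many
pieces cover `Ω`. The affine formulas extend to these closures, and the map is a continuous
selection of them and `M₀`. The bound `L` is the same for all stages. -/
lemma lipschitz (s : Stage 𝒞 S Ω M₀ L) (h𝒞 : IsDomainClass 𝒞) (hΩ : Ω ∈ 𝒞) (hM : ‖M₀‖ ≤ L) :
    LipschitzWith L s.u := by
  refine lipschitzWith_of_affine_selection s.u s.continuous
    (fun o : Option s.ι => o.elim M₀ s.A) (fun o => o.elim 0 s.b) L ?_ fun x => ?_
  · rintro (_ | c)
    · exact hM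
    · exact s.bounded c
  by_cases hx : x ∈ Ω
  · have hdense : x ∈ closure (⋃ c, s.P c) := by
      by_contra hcl
      have hopen : IsOpen (Ω \ closure (⋃ c, s.P c)) :=
        (h𝒞.isOpen Ω hΩ).sdiff isClosed_closure
      have hpos : 0 < volume (Ω \ closure (⋃ c, s.P c)) := hopen.measure_pos volume ⟨x, hx, hcl⟩
      exact hpos.ne' (measure_mono_null (sdiff_subset_sdiff_right subset_closure) s.cover)
    rw [closure_iUnion_of_finite] at hdense
    obtain ⟨c, hc⟩ := mem_iUnion.1 hdense
    refine ⟨some c, ?_⟩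
    have hcl : IsClosed {y | s.u y = s.A c y + s.b c} :=
      isClosed_eq s.continuous (by fun_prop)
    exact closure_minimal (fun y hy => s.affine c y hy) hcl hc
  · exact ⟨none, by simp [s.outside x hx]⟩

lemma ae_fderiv (s : Stage 𝒞 S Ω M₀ L) (h𝒞 : IsDomainClass 𝒞) (hΩ : Ω ∈ 𝒞) (hM : ‖M₀‖ ≤ L) :
    ∀ᵐ x ∂(volume : Measure (E n)), (x ∉ Ω → fderiv ℝ s.u x = M₀) ∧
      (∀ c, x ∈ s.P c → fderiv ℝ s.u x = s.A c) ∧ (x ∈ Ω → ∃ c, x ∈ s.P c) := by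
  have hl := s.lipschitz h𝒞 hΩ hM
  have hΩm : MeasurableSet Ω := (h𝒞.isOpen Ω hΩ).measurableSet
  have h1 := fderiv_ae_eq_of_eqOn_affine hl hΩm.compl M₀ 0
    (fun x hx => by simpa using s.outside x hx)
  rw [ae_restrict_iff' hΩm.compl] at h1
  have h2 : ∀ᵐ x ∂(volume : Measure (E n)), ∀ c, x ∈ s.P c → fderiv ℝ s.u x = s.A c := by
    refine ae_all_iff.2 fun c => ?_
    have hm : MeasurableSet (s.P c) := (h𝒞.isOpen _ (s.mem_class c)).measurableSet
    rw [← ae_restrict_iff' hm]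
    exact fderiv_ae_eq_of_eqOn_affine hl hm (s.A c) (s.b c) (s.affine c)
  have h3 : ∀ᵐ x ∂(volume : Measure (E n)), x ∉ Ω \ ⋃ c, s.P c := measure_eq_zero_iff_ae_notMem.1 s.cover
  filter_upwards [h1, h2, h3] with x hx1 hx2 hx3
  refine ⟨hx1, hx2, fun hx => ?_⟩
  by_contra hne
  exact hx3 ⟨hx, fun h => hne (mem_iUnion.1 h)⟩

/-- The one-piece stage given by the affine map `M₀`. -/
def initial (hΩ : Ω ∈ 𝒞) (d₀ : ℕ) (hM₀ : M₀ ∈ S d₀) (hL : ‖M₀‖ ≤ L) : Stage 𝒞 S Ω M₀ L where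
  ι := Unit
  fintype := inferInstance
  u := M₀
  P := fun _ => Ω
  A := fun _ => M₀
  b := fun _ => 0
  d := fun _ => d₀
  continuous := M₀.continuous
  mem_class := fun _ => hΩ
  subset := fun _ => subset_rfl
  disjoint := fun c c' h => absurd (Subsingleton.elim c c') h
  cover := measure_mono_null (fun _ hx => hx.2 (mem_iUnion.2 ⟨(), hx.1⟩)) measure_empty
  affine := by simp
  outside := fun _ _ => rfl
  mem := fun _ => hM₀
  bounded := fun _ => hL

/-- `t` is obtained from `s` by one step of the scheme. -/
structure Next (s t : Stage 𝒞 S Ω M₀ L) (wt : ℕ → Mat n → Set (E n) → ℝ≥0∞)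
    (ρ q B Λ : ℝ) : Prop where
  parent : ∀ c', ∃ c, t.P c' ⊆ s.P c ∧ (t.d c' = s.d c ∨ t.d c' = s.d c + 1)
  depthVolume_le : t.depthVolume q ≤ ENNReal.ofReal ρ * s.depthVolume q
  weightedPerimeter_le : t.weightedPerimeter wt ≤ ENNReal.ofReal Λ * s.weightedPerimeter wt
  lintegral_le : ∫⁻ x, ‖fderiv ℝ t.u x - fderiv ℝ s.u x‖ₑ ≤ ENNReal.ofReal B * s.depthVolume q

end Stage

/-- Going one deeper removes the fraction `1 - q` of the weight of the good pieces, which carry at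
least `v₁ |D|`; the bad pieces keep their weight. -/
lemma Replacement.depthVolume_le {v₁ C₃ q : ℝ} (hv₁ : 0 < v₁ ∧ v₁ < 1) (hq : 0 < q ∧ q < 1)
    {D : Set (E n)} {M : Mat n} {T : Set (Mat n)} (h𝒞 : IsDomainClass 𝒞) (hD : D ∈ 𝒞)
    (R : Replacement 𝒞 v₁ C₃ D M T) (d : ℕ) :
    ∑ i, ENNReal.ofReal (q ^ (if i ∈ R.g then d + 1 else d)) * volume (R.P i) ≤
      ENNReal.ofReal (1 - v₁ * (1 - q)) * (ENNReal.ofReal (q ^ d) * volume D) := by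
  have hm : ∀ i, MeasurableSet (R.P i) := fun i => (h𝒞.isOpen _ (R.mem_class i)).measurableSet
  have hdis : Pairwise (Function.onFun Disjoint R.P) := fun i j hij => R.disjoint i j hij
  have hDfin : volume D ≠ ⊤ := (h𝒞.isBounded D hD).measure_lt_top.ne
  have hfin : ∀ i, volume (R.P i) ≠ ⊤ := fun i =>
    ne_top_of_le_ne_top hDfin (measure_mono (R.subset i))
  have hall : ∑ i, volume (R.P i) ≤ volume D := by
    rw [← tsum_fintype (L := .unconditional _), ← measure_iUnion hdis hm]
    exact measure_mono (iUnion_subset R.subset)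
  have hgood : ENNReal.ofReal v₁ * volume D ≤ ∑ i ∈ R.g, volume (R.P i) := by
    rw [← measure_biUnion_finset (fun i _ j _ hij => R.disjoint i j hij) (fun i _ => hm i)]
    exact R.volume_good
  have hall' : ∑ i, (volume (R.P i)).toReal ≤ (volume D).toReal := by
    rw [← ENNReal.toReal_sum fun i _ => hfin i]
    exact ENNReal.toReal_mono hDfin hall
  have hgood' : v₁ * (volume D).toReal ≤ ∑ i ∈ R.g, (volume (R.P i)).toReal := by
    rw [← ENNReal.toReal_sum fun i _ => hfin i]
    have := ENNReal.toReal_mono (ENNReal.sum_ne_top.2 fun i _ => hfin i) hgood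
    rwa [ENNReal.toReal_mul, ENNReal.toReal_ofReal hv₁.1.le] at this
  have hsplit : ∑ i, (volume (R.P i)).toReal =
      ∑ i ∈ R.g, (volume (R.P i)).toReal + ∑ i ∈ R.gᶜ, (volume (R.P i)).toReal :=
    (Finset.sum_add_sum_compl _ _).symm
  have hterm : ∀ i, ENNReal.ofReal (q ^ (if i ∈ R.g then d + 1 else d)) * volume (R.P i) =
      ENNReal.ofReal (q ^ (if i ∈ R.g then d + 1 else d) * (volume (R.P i)).toReal) := by
    intro i
    have : 0 ≤ q := hq.1.le
    rw [ENNReal.ofReal_mul (by positivity), ENNReal.ofReal_toReal (hfin i)]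
  have hq0 : 0 ≤ q := hq.1.le
  have hρ : 0 ≤ 1 - v₁ * (1 - q) := by nlinarith
  calc ∑ i, ENNReal.ofReal (q ^ (if i ∈ R.g then d + 1 else d)) * volume (R.P i)
      = ENNReal.ofReal (∑ i, q ^ (if i ∈ R.g then d + 1 else d) * (volume (R.P i)).toReal) := by
        rw [ENNReal.ofReal_sum_of_nonneg fun i _ => by positivity]
        exact Finset.sum_congr rfl fun i _ => hterm i
    _ ≤ ENNReal.ofReal ((1 - v₁ * (1 - q)) * (q ^ d * (volume D).toReal)) := by
        refine ENNReal.ofReal_le_ofReal ?_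
        have e : ∑ i, q ^ (if i ∈ R.g then d + 1 else d) * (volume (R.P i)).toReal =
            q ^ d * (q * ∑ i ∈ R.g, (volume (R.P i)).toReal +
              ∑ i ∈ R.gᶜ, (volume (R.P i)).toReal) := by
          rw [← Finset.sum_add_sum_compl R.g, mul_add, Finset.mul_sum, Finset.mul_sum,
            Finset.mul_sum]
          congr 1
          · refine Finset.sum_congr rfl fun i hi => ?_
            rw [if_pos hi, pow_succ]; ring
          · refine Finset.sum_congr rfl fun i hi => ?_
            rw [if_neg (Finset.mem_compl.1 hi)]
        rw [e]
        have : q * ∑ i ∈ R.g, (volume (R.P i)).toReal + ∑ i ∈ R.gᶜ, (volume (R.P i)).toReal ≤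
            (1 - v₁ * (1 - q)) * (volume D).toReal := by
          have h1q : 0 ≤ 1 - q := by linarith [hq.2]
          nlinarith [mul_le_mul_of_nonneg_left hgood' h1q]
        calc _ ≤ q ^ d * ((1 - v₁ * (1 - q)) * (volume D).toReal) := by gcongr
          _ = _ := by ring
    _ = _ := by
        rw [ENNReal.ofReal_mul hρ, ENNReal.ofReal_mul (by positivity), ENNReal.ofReal_toReal hDfin]

lemma Replacement.perturbation_continuous {v₁ C₃ : ℝ} {D : Set (E n)} {M : Mat n} {T : Set (Mat n)}
    (R : Replacement 𝒞 v₁ C₃ D M T) : Continuous (D.indicator fun x => R.u x - M x) :=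
  continuous_indicator (fun x hx => by simp [R.boundary x hx])
    (R.continuousOn.sub M.continuous.continuousOn)

/-- In each piece the perturbation `(R c).u - A c` vanishes on the boundary, so it can be extended
by zero and added to the old map. It has zero gradient on bad pieces, hence only good pieces
contribute to the change of the gradient. -/
lemma Stage.exists_next {v₁ C₃ q B Λ : ℝ} (hv₁ : 0 < v₁ ∧ v₁ < 1) (hq : 0 < q ∧ q < 1)
    (hB : 0 ≤ B)
    (h𝒞 : IsDomainClass 𝒞) (hΩ : Ω ∈ 𝒞) (hM : ‖M₀‖ ≤ L) (hC₃ : C₃ ≤ L)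
    {wt : ℕ → Mat n → Set (E n) → ℝ≥0∞} (hstep : StepRule 𝒞 S wt v₁ C₃ q B Λ L)
    (s : Stage 𝒞 S Ω M₀ L) :
    ∃ t : Stage 𝒞 S Ω M₀ L, s.Next t wt (1 - v₁ * (1 - q)) q B Λ := by
  classical
  choose R hRper hRgrad using fun c => 
    hstep (s.d c) (s.P c) (s.mem_class c) (s.A c) (s.mem c) (s.bounded c)
  choose β hβ using fun c => (R c).affine
  let u' : E n → E n := fun x =>
    s.u x + ∑ c, (s.P c).indicator (fun x => (R c).u x - s.A c x) x
  have hu'in : ∀ c, ∀ x ∈ s.P c, u' x = (R c).u x + s.b c := by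
    intro c x hx
    have : ∑ c', (s.P c').indicator (fun x => (R c').u x - s.A c' x) x =
        (R c).u x - s.A c x := by
      rw [Finset.sum_eq_single c]
      · exact indicator_of_mem hx _
      · intro c' _ hcc
        exact indicator_of_notMem (fun h => (s.disjoint c' c hcc).le_bot ⟨h, hx⟩) _
      · simp
    simp only [u']
    rw [this, s.affine c x hx]
    abel
  let t : Stage 𝒞 S Ω M₀ L :=
    { ι := Σ c : s.ι, Fin (R c).N
      fintype := inferInstance
      u := u'
      P := fun z => (R z.1).P z.2
      -- On bad pieces the old matrix is recorded instead of `(R z.1).A`: it represents the map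
      -- there and is the one known to lie in the set of the unchanged depth.
      A := fun z => if z.2 ∈ (R z.1).g then (R z.1).A z.2 else s.A z.1
      b := fun z => if z.2 ∈ (R z.1).g then β z.1 z.2 + s.b z.1 else s.b z.1
      d := fun z => if z.2 ∈ (R z.1).g then s.d z.1 + 1 else s.d z.1
      continuous := s.continuous.add
        (continuous_finsetSum _ fun c _ => (R c).perturbation_continuous)
      mem_class := fun z => (R z.1).mem_class z.2
      subset := fun z => ((R z.1).subset z.2).trans (s.subset z.1)
      disjoint := by
        rintro ⟨c, i⟩ ⟨c', i'⟩ hne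
        by_cases hc : c = c'
        · subst hc
          exact (R c).disjoint i i' fun h => hne (by rw [h])
        · exact (s.disjoint c c' hc).mono ((R c).subset i) ((R c').subset i')
      cover := by
        refine measure_mono_null (t := (Ω \ ⋃ c, s.P c) ∪ ⋃ c, (s.P c \ ⋃ i, (R c).P i)) ?_ ?_
        · rintro x ⟨hx, hx'⟩
          by_cases h : x ∈ ⋃ c, s.P c
          · obtain ⟨c, hc⟩ := mem_iUnion.1 h
            refine Or.inr (mem_iUnion.2 ⟨c, hc, fun hi => hx' ?_⟩)
            obtain ⟨i, hi⟩ := mem_iUnion.1 hi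
            exact mem_iUnion.2 ⟨⟨c, i⟩, hi⟩
          · exact Or.inl ⟨hx, h⟩
        · exact measure_union_null s.cover (measure_iUnion_null fun c => (R c).cover)
      affine := by
        rintro ⟨c, i⟩ x hx
        simp only
        rw [hu'in c x ((R c).subset i hx)]
        split_ifs with hg
        · rw [hβ c i x hx]; abel
        · rw [(R c).unchanged i hg x hx]
      outside := by
        intro x hx
        have : ∑ c', (s.P c').indicator (fun x => (R c').u x - s.A c' x) x = 0 :=
          Finset.sum_eq_zero fun c _ => indicator_of_notMem (fun h => hx (s.subset c h)) _
        simp only [u']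
        rw [this, add_zero, s.outside x hx]
      mem := by
        rintro ⟨c, i⟩
        simp only
        split_ifs with hg
        · exact (R c).target i hg
        · exact s.mem c
      bounded := by
        rintro ⟨c, i⟩
        simp only
        split_ifs with hg
        · exact ((R c).bounded i).trans hC₃
        · exact s.bounded c }
  refine ⟨t, ?_, ?_, ?_, ?_⟩
  · rintro ⟨c, i⟩
    refine ⟨c, (R c).subset i, ?_⟩
    by_cases hg : i ∈ (R c).g
    · exact Or.inr (if_pos hg)
    · exact Or.inl (if_neg hg)
  · unfold Stage.depthVolume
    rw [Finset.mul_sum, Fintype.sum_sigma]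
    exact Finset.sum_le_sum fun c _ =>
      (R c).depthVolume_le hv₁ hq h𝒞 (s.mem_class c) (s.d c)
  · unfold Stage.weightedPerimeter
    rw [Finset.mul_sum, Fintype.sum_sigma]
    refine Finset.sum_le_sum fun c _ => le_trans (le_of_eq ?_) (hRper c)
    refine Finset.sum_congr rfl fun i _ => ?_
    by_cases hg : i ∈ (R c).g <;> simp [t, hg]
  · have hle : ∀ᵐ x ∂(volume : Measure (E n)), ‖fderiv ℝ t.u x - fderiv ℝ s.u x‖ₑ ≤
        ∑ c, ∑ i ∈ (R c).g, ((R c).P i).indicator (fun _ => ‖(R c).A i - s.A c‖ₑ) x := by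
      filter_upwards [s.ae_fderiv h𝒞 hΩ hM, t.ae_fderiv h𝒞 hΩ hM] with x hs ht
      by_cases hx : x ∈ Ω
      · obtain ⟨⟨c, i⟩, hci⟩ := ht.2.2 hx
        have hci' : x ∈ (R c).P i := hci
        rw [ht.2.1 ⟨c, i⟩ hci, hs.2.1 c ((R c).subset i hci)]
        by_cases hg : i ∈ (R c).g
        · have e : t.A ⟨c, i⟩ = (R c).A i := if_pos hg
          rw [e]
          refine le_trans ?_ (Finset.single_le_sum (fun _ _ => zero_le) (Finset.mem_univ c))
          refine le_trans ?_ (Finset.single_le_sum (fun _ _ => zero_le) hg)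
          rw [indicator_of_mem hci']
        · have e : t.A ⟨c, i⟩ = s.A c := if_neg hg
          rw [e]; exact le_of_eq_of_le (enorm_sub_self _) zero_le
      · rw [ht.1 hx, hs.1 hx]; exact le_of_eq_of_le (enorm_sub_self _) zero_le
    have hm : ∀ c i, MeasurableSet ((R c).P i) := fun c i =>
      (h𝒞.isOpen _ ((R c).mem_class i)).measurableSet
    calc ∫⁻ x, ‖fderiv ℝ t.u x - fderiv ℝ s.u x‖ₑ
        ≤ ∫⁻ x, ∑ c, ∑ i ∈ (R c).g, ((R c).P i).indicator (fun _ => ‖(R c).A i - s.A c‖ₑ) x :=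
          lintegral_mono_ae hle
      _ = ∑ c, ∑ i ∈ (R c).g, ‖(R c).A i - s.A c‖ₑ * volume ((R c).P i) := by
          rw [lintegral_finsetSum _ fun c _ => Finset.measurable_fun_sum _ fun i _ =>
            measurable_const.indicator (hm c i)]
          refine Finset.sum_congr rfl fun c _ => ?_
          rw [lintegral_finsetSum _ fun i _ => measurable_const.indicator (hm c i)]
          exact Finset.sum_congr rfl fun i _ => lintegral_indicator_const (hm c i) _
      _ ≤ ∑ c, ENNReal.ofReal (B * q ^ s.d c) * volume (s.P c) :=
          Finset.sum_le_sum fun c _ => hRgrad c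
      _ = ENNReal.ofReal B * s.depthVolume q := by
          unfold Stage.depthVolume
          rw [Finset.mul_sum]
          refine Finset.sum_congr rfl fun c _ => ?_
          rw [ENNReal.ofReal_mul hB, mul_assoc]

/-! ### Passage to the limit -/

/-- A discrete intermediate value theorem. The bound on `i` from below later makes the chosen
indices tend to infinity. -/
lemma exists_index_eq {D : ℕ → ℕ} (hD : ∀ i, D (i + 1) = D i ∨ D (i + 1) = D i + 1)
    (hunb : ∀ N, ∃ i, N < D i) (k : ℕ) (hk : D 0 ≤ k) : ∃ i, D i = k ∧ k ≤ D 0 + i := by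
  classical
  have hle : ∀ i, D i ≤ D 0 + i := by
    intro i
    induction i with
    | zero => simp
    | succ i ih => rcases hD i with h | h <;> omega
  have hex : ∃ i, k ≤ D i := (hunb k).imp fun i h => h.le
  have h1 := Nat.find_spec hex
  have h2 : D (Nat.find hex) = k := by
    rcases Nat.eq_zero_or_pos (Nat.find hex) with h0 | h0
    · rw [h0] at h1 ⊢; omega
    · have h3 := Nat.find_min hex (m := Nat.find hex - 1) (by omega)
      have h4 := hD (Nat.find hex - 1)
      rw [Nat.sub_add_cancel h0] at h4
      omega
  exact ⟨_, h2, h2.symm.le.trans (hle _)⟩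

lemma Stage.lintegral_depth (s : Stage 𝒞 S Ω M₀ L) (h𝒞 : IsDomainClass 𝒞) (q : ℝ) :
    ∫⁻ x, ∑ c, (s.P c).indicator (fun _ => ENNReal.ofReal (q ^ s.d c)) x = s.depthVolume q := by
  have hm : ∀ c, MeasurableSet (s.P c) := fun c => (h𝒞.isOpen _ (s.mem_class c)).measurableSet
  rw [lintegral_finsetSum _ fun c _ => measurable_const.indicator (hm c)]
  exact Finset.sum_congr rfl fun c _ => lintegral_indicator_const (hm c) _

/-- Limits of the gradients lie in `K` almost everywhere. -/
lemma ae_limit_mem (h𝒞 : IsDomainClass 𝒞) (hΩ : Ω ∈ 𝒞) (hM : ‖M₀‖ ≤ L)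
    (σ : ℕ → Stage 𝒞 S Ω M₀ L) {q : ℝ} (hq : 0 < q ∧ q < 1)
    (hparent : ∀ i c', ∃ c, (σ (i + 1)).P c' ⊆ (σ i).P c ∧
      ((σ (i + 1)).d c' = (σ i).d c ∨ (σ (i + 1)).d c' = (σ i).d c + 1))
    (hsum : ∑' i, (σ i).depthVolume q ≠ ⊤) (K : Set (Mat n))
    (hK : ∀ (W : ℕ → Mat n) (A : Mat n), (∀ᶠ i in atTop, W i ∈ S i) →
      Tendsto W atTop (𝓝 A) → A ∈ K) :
    ∀ᵐ x ∂(volume : Measure (E n)), x ∈ Ω → ∀ A : Mat n,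
      Tendsto (fun i => fderiv ℝ (σ i).u x) atTop (𝓝 A) → A ∈ K := by
  let δ : ℕ → E n → ℝ≥0∞ := fun i x =>
    ∑ c, ((σ i).P c).indicator (fun _ => ENNReal.ofReal (q ^ (σ i).d c)) x
  have hδm : ∀ i, Measurable (δ i) := fun i =>
    Finset.measurable_fun_sum _ fun c _ => measurable_const.indicator
      (h𝒞.isOpen _ ((σ i).mem_class c)).measurableSet
  have hfin : ∀ᵐ x ∂(volume : Measure (E n)), ∑' i, δ i x < ⊤ := by
    refine ae_lt_top (Measurable.tsum hδm) ?_
    rw [lintegral_tsum fun i => (hδm i).aemeasurable]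
    simp only [δ, Stage.lintegral_depth _ h𝒞]
    exact hsum
  filter_upwards [hfin, ae_all_iff.2 fun i => (σ i).ae_fderiv h𝒞 hΩ hM] with x hx1 hx2 hxΩ A hA
  choose c hc using fun i => (hx2 i).2.2 hxΩ
  let D : ℕ → ℕ := fun i => (σ i).d (c i)
  have hD : ∀ i, D (i + 1) = D i ∨ D (i + 1) = D i + 1 := by
    intro i
    obtain ⟨c', hsub, hd⟩ := hparent i (c (i + 1))
    have : c' = c i := by
      by_contra hne
      exact ((σ i).disjoint c' (c i) hne).le_bot ⟨hsub (hc (i + 1)), hc i⟩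
    rw [this] at hd
    exact hd
  have hmono : Monotone D := monotone_nat_of_le_succ fun i => by rcases hD i with h | h <;> omega
  -- If the depth at `x` stayed below `N`, every term `δ i x` would be at least `q ^ N`, against
  -- summability.
  have hunb : ∀ N, ∃ i, N < D i := by
    intro N
    by_contra hcon
    push Not at hcon
    have ht := ENNReal.tendsto_atTop_zero_of_tsum_ne_top hx1.ne
    have hpos : 0 < ENNReal.ofReal (q ^ N) := ENNReal.ofReal_pos.2 (pow_pos hq.1 N)
    have hlow : ∀ i, ENNReal.ofReal (q ^ N) ≤ δ i x := by
      intro i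
      refine le_trans ?_ (Finset.single_le_sum (fun _ _ => zero_le) (Finset.mem_univ (c i)))
      rw [indicator_of_mem (hc i)]
      exact ENNReal.ofReal_le_ofReal (pow_le_pow_of_le_one hq.1.le hq.2.le (hcon i))
    exact absurd (ge_of_tendsto' ht hlow) (not_le.2 hpos)
  -- The value `0` for `k < D 0` is a dummy; finitely many indices are irrelevant in the closing
  -- condition.
  have hidx : ∀ k, ∃ i, D 0 ≤ k → D i = k ∧ k ≤ D 0 + i := by
    intro k
    by_cases hk : D 0 ≤ k
    · exact (exists_index_eq hD hunb k hk).imp fun i h _ => h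
    · exact ⟨0, fun h => absurd h hk⟩
  choose I hI using hidx
  have hIt : Tendsto I atTop atTop := by
    refine tendsto_atTop_mono' atTop ?_ (tendsto_sub_atTop_nat (D 0))
    filter_upwards [eventually_ge_atTop (D 0)] with k hk
    have := (hI k hk).2
    omega
  refine hK (fun k => fderiv ℝ (σ (I k)).u x) A ?_ (hA.comp hIt)
  filter_upwards [eventually_ge_atTop (D 0)] with k hk
  rw [(hx2 (I k)).2.1 _ (hc (I k))]
  have := (σ (I k)).mem (c (I k))
  have e : (σ (I k)).d (c (I k)) = k := (hI k hk).1
  rwa [e] at this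

lemma Stage.norm_u_le (s : Stage 𝒞 S Ω M₀ L) (h𝒞 : IsDomainClass 𝒞) (hΩ : Ω ∈ 𝒞) (hM : ‖M₀‖ ≤ L)
    {x₀ : E n} (hx₀ : x₀ ∉ Ω) (x : E n) : ‖s.u x‖ ≤ ‖M₀ x₀‖ + L * ‖x - x₀‖ := by
  have h := (s.lipschitz h𝒞 hΩ hM).norm_sub_le x x₀
  rw [← s.outside x₀ hx₀]
  calc ‖s.u x‖ = ‖s.u x₀ + (s.u x - s.u x₀)‖ := by congr 1; abel
    _ ≤ _ := (norm_add_le _ _).trans (by gcongr)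

/-- A pointwise limit of stages has the limit of the gradients as its weak gradient. -/
lemma hasWeakGradient_of_limit (hn : 0 < n) (h𝒞 : IsDomainClass 𝒞) (hΩ : Ω ∈ 𝒞) (hM : ‖M₀‖ ≤ L)
    (σ : ℕ → Stage 𝒞 S Ω M₀ L) {u : E n → E n} {Du : E n → Mat n} (hum : Measurable u)
    (hDum : Measurable Du)
    (hu : ∀ᵐ x ∂(volume : Measure (E n)), Tendsto (fun i => (σ i).u x) atTop (𝓝 (u x)))
    (hDu : ∀ᵐ x ∂(volume : Measure (E n)),
      Tendsto (fun i => fderiv ℝ (σ i).u x) atTop (𝓝 (Du x))) :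
    HasWeakGradientW1InftyLoc u Du := by
  have : Nontrivial (E n) := by
    have : Nonempty (Fin n) := ⟨⟨0, hn⟩⟩
    infer_instance
  -- All stages agree with `M₀` at a point outside the bounded set `Ω`; with the common Lipschitz
  -- constant this gives the dominating function.
  obtain ⟨x₀, hx₀⟩ : ∃ x₀, x₀ ∉ Ω := by
    obtain ⟨r, hr⟩ := (h𝒞.isBounded Ω hΩ).subset_ball (0 : E n)
    obtain ⟨x, hx⟩ := NormedSpace.exists_lt_norm ℝ (E n) r
    exact ⟨x, fun h => absurd (mem_ball_zero_iff.1 (hr h)) (not_lt.2 hx.le)⟩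
  have hbu : ∀ i x, ‖(σ i).u x‖ ≤ ‖M₀ x₀‖ + L * ‖x - x₀‖ := fun i x =>
    (σ i).norm_u_le h𝒞 hΩ hM hx₀ x
  have hbD : ∀ i x, ‖fderiv ℝ (σ i).u x‖ ≤ L := fun i x =>
    norm_fderiv_le_of_lipschitz ℝ ((σ i).lipschitz h𝒞 hΩ hM)
  refine ⟨fun Q hQ => ?_, fun Q hQ => ?_, fun φ hφ hφc v => ?_⟩
  · obtain ⟨C, hC⟩ := hQ.exists_bound_of_continuousOn
      (f := fun x : E n => ‖M₀ x₀‖ + L * ‖x - x₀‖) (by fun_prop)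
    refine memLp_top_of_bound hum.aestronglyMeasurable C ?_
    filter_upwards [ae_restrict_mem hQ.measurableSet, ae_restrict_of_ae hu] with x hxQ hx
    exact le_of_tendsto' hx.norm fun i =>
      (hbu i x).trans ((Real.le_norm_self _).trans (hC x hxQ))
  · refine memLp_top_of_bound hDum.aestronglyMeasurable L ?_
    filter_upwards [ae_restrict_of_ae hDu] with x hx
    exact le_of_tendsto' hx.norm fun i => hbD i x
  · have hφ1 : ContDiff ℝ 1 φ := hφ.of_le (by exact_mod_cast le_top)
    have hdφ : Continuous fun x => fderiv ℝ φ x v :=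
      (hφ1.continuous_fderiv (by norm_num)).clm_apply continuous_const
    have hdφc : HasCompactSupport fun x => fderiv ℝ φ x v := hφc.fderiv_apply (𝕜 := ℝ) v
    have t1 : Tendsto (fun i => ∫ x, (fderiv ℝ φ x v) • (σ i).u x) atTop
        (𝓝 (∫ x, (fderiv ℝ φ x v) • u x)) := by
      refine tendsto_integral_of_dominated_convergence
        (fun x => ‖fderiv ℝ φ x v‖ * (‖M₀ x₀‖ + L * ‖x - x₀‖)) (fun i => ?_) ?_ (fun i => ?_) ?_
      · exact (hdφ.smul (σ i).continuous).aestronglyMeasurable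
      · exact (hdφ.norm.mul (by fun_prop)).integrable_of_hasCompactSupport hdφc.norm.mul_right
      · refine Eventually.of_forall fun x => ?_
        rw [norm_smul]
        gcongr
        exact hbu i x
      · filter_upwards [hu] with x hx using hx.const_smul _
    have t2 : Tendsto (fun i => ∫ x, φ x • fderiv ℝ (σ i).u x v) atTop
        (𝓝 (∫ x, φ x • Du x v)) := by
      refine tendsto_integral_of_dominated_convergence
        (fun x => ‖φ x‖ * (L * ‖v‖)) (fun i => ?_) ?_ (fun i => ?_) ?_
      · exact (hφ.continuous.measurable.smul
          (measurable_fderiv_apply_const ℝ _ v)).aestronglyMeasurable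
      · exact (hφ.continuous.integrable_of_hasCompactSupport hφc).norm.mul_const _
      · refine Eventually.of_forall fun x => ?_
        rw [norm_smul]
        gcongr
        refine (ContinuousLinearMap.le_opNorm _ _).trans ?_
        gcongr
        exact hbD i x
      · filter_upwards [hDu] with x hx
        exact ((ContinuousLinearMap.apply ℝ (E n) v).continuous.tendsto _ |>.comp hx).const_smul _
    have e : (fun i => ∫ x, (fderiv ℝ φ x v) • (σ i).u x) =
        fun i => - ∫ x, φ x • fderiv ℝ (σ i).u x v := funext fun i =>
      integral_fderiv_smul_eq ((σ i).lipschitz h𝒞 hΩ hM) φ hφ hφc v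
    rw [e] at t1
    exact tendsto_nhds_unique t1 t2.neg

/-- The increments of the maps are controlled by the increments of the gradients. -/
lemma Stage.lintegral_sub_le (hn : 0 < n) (h𝒞 : IsDomainClass 𝒞) (hΩ : Ω ∈ 𝒞) (hM : ‖M₀‖ ≤ L)
    (s t : Stage 𝒞 S Ω M₀ L) {R : ℝ} (hR : Ω ⊆ Metric.closedBall 0 R) :
    ∫⁻ x, ‖t.u x - s.u x‖ₑ ≤
      ENNReal.ofReal R * ∫⁻ x, ‖fderiv ℝ t.u x - fderiv ℝ s.u x‖ₑ := by
  have hs := s.lipschitz h𝒞 hΩ hM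
  have ht := t.lipschitz h𝒞 hΩ hM
  have h := lintegral_enorm_le_fderiv hn (ht.sub hs) R (fun x hx => by
    have hx' : x ∉ Ω := fun h => hx (hR h)
    simp [s.outside x hx', t.outside x hx'])
  refine h.trans (le_of_eq ?_)
  congr 1
  refine lintegral_congr_ae ?_
  have hs' : ∀ᵐ x ∂(volume : Measure (E n)), DifferentiableAt ℝ s.u x := hs.ae_differentiableAt
  have ht' : ∀ᵐ x ∂(volume : Measure (E n)), DifferentiableAt ℝ t.u x := ht.ae_differentiableAt
  filter_upwards [hs', ht'] with x hx1 hx2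
  rw [fderiv_fun_sub hx2 hx1]

/-- The convex integration scheme: solutions together with piecewise constant approximations of
the gradient that converge exponentially while their perimeters grow at most exponentially. -/
theorem exists_solution_of_stepRule (hn : 0 < n) {v₁ C₃ q B Λ : ℝ} (hv₁ : 0 < v₁ ∧ v₁ < 1)
    (hq : 0 < q ∧ q < 1) (hB : 0 ≤ B) (hΛ : 0 ≤ Λ) (h𝒞 : IsDomainClass 𝒞) (hΩ : Ω ∈ 𝒞)
    (hM : ‖M₀‖ ≤ L) (hC₃ : C₃ ≤ L) {wt : ℕ → Mat n → Set (E n) → ℝ≥0∞}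
    (hstep : StepRule 𝒞 S wt v₁ C₃ q B Λ L) (hwt : ∀ d M D, 1 ≤ wt d M D) {d₀ : ℕ}
    (hM₀ : M₀ ∈ S d₀) (hwt₀ : wt d₀ M₀ Ω ≠ ⊤) (K : Set (Mat n))
    (hK : ∀ (W : ℕ → Mat n) (A : Mat n), (∀ᶠ i in atTop, W i ∈ S i) →
      Tendsto W atTop (𝓝 A) → A ∈ K) :
    ∃ (u : E n → E n) (Du : E n → Mat n), HasWeakGradientW1InftyLoc u Du ∧ Measurable Du ∧
      (∀ᵐ x ∂(volume.restrict Ω), Du x ∈ K) ∧ (∀ᵐ x ∂(volume.restrict Ωᶜ), Du x = M₀) ∧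
      ∃ C : ℝ, 0 ≤ C ∧ ∀ i : ℕ, ∃ s : Stage 𝒞 S Ω M₀ L,
        ∫⁻ x, ‖fderiv ℝ s.u x - Du x‖ₑ ≤ ENNReal.ofReal (C * (1 - v₁ * (1 - q)) ^ i) ∧
        ∑ c, perimeter (s.P c) ≤ ENNReal.ofReal (C * Λ ^ i) := by
  classical
  set ρ : ℝ := 1 - v₁ * (1 - q) with hρ
  have hρ0 : 0 ≤ ρ := by nlinarith [hv₁.1, hv₁.2, hq.1, hq.2]
  have hρ1 : ρ < 1 := by nlinarith [hv₁.1, hv₁.2, hq.1, hq.2]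
  have hΩm : MeasurableSet Ω := (h𝒞.isOpen Ω hΩ).measurableSet
  choose next hnext using fun s : Stage 𝒞 S Ω M₀ L =>
    s.exists_next hv₁ hq hB h𝒞 hΩ hM hC₃ hstep
  let s₀ : Stage 𝒞 S Ω M₀ L := Stage.initial hΩ d₀ hM₀ hM
  obtain ⟨σ, hσ0, hσ⟩ : ∃ σ : ℕ → Stage 𝒞 S Ω M₀ L, σ 0 = s₀ ∧
      ∀ i, (σ i).Next (σ (i + 1)) wt ρ q B Λ :=
    ⟨fun i => Nat.rec s₀ (fun _ s => next s) i, rfl, fun i => hnext _⟩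
  set r : ℝ≥0∞ := ENNReal.ofReal ρ with hr
  have hr1 : r < 1 := by rw [hr, ← ENNReal.ofReal_one]; exact (ENNReal.ofReal_lt_ofReal_iff one_pos).2 hρ1
  have hV : ∀ i, (σ i).depthVolume q ≤ s₀.depthVolume q * r ^ i := by
    intro i
    induction i with
    | zero => simp [hσ0]
    | succ i ih =>
      calc (σ (i + 1)).depthVolume q ≤ r * (σ i).depthVolume q := (hσ i).depthVolume_le
        _ ≤ r * (s₀.depthVolume q * r ^ i) := by gcongr
        _ = _ := by ring
  have hV0 : s₀.depthVolume q ≠ ⊤ :=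
    ENNReal.sum_ne_top.2 fun _ _ => ENNReal.mul_ne_top ENNReal.ofReal_ne_top
      (h𝒞.isBounded Ω hΩ).measure_lt_top.ne
  have hP : ∀ i, (σ i).weightedPerimeter wt ≤ s₀.weightedPerimeter wt * ENNReal.ofReal Λ ^ i := by
    intro i
    induction i with
    | zero => simp [hσ0]
    | succ i ih =>
      calc (σ (i + 1)).weightedPerimeter wt ≤ ENNReal.ofReal Λ * (σ i).weightedPerimeter wt :=
            (hσ i).weightedPerimeter_le
        _ ≤ ENNReal.ofReal Λ * (s₀.weightedPerimeter wt * ENNReal.ofReal Λ ^ i) := by gcongr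
        _ = _ := by ring
  have hP0 : s₀.weightedPerimeter wt ≠ ⊤ :=
    ENNReal.sum_ne_top.2 fun _ _ => ENNReal.mul_ne_top hwt₀ (h𝒞.perimeter_lt_top Ω hΩ).ne
  set a : ℝ≥0∞ := ENNReal.ofReal B * s₀.depthVolume q with ha
  have ha' : a ≠ ⊤ := ENNReal.mul_ne_top ENNReal.ofReal_ne_top hV0
  have hgrad : ∀ i, ∫⁻ x, ‖fderiv ℝ (σ (i + 1)).u x - fderiv ℝ (σ i).u x‖ₑ ≤ a * r ^ i := by
    intro i
    refine (hσ i).lintegral_le.trans ?_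
    rw [ha, mul_assoc]
    gcongr
    exact hV i
  obtain ⟨Du, hDum, hDut, hDui⟩ := exists_limit_of_geometric
    (fun i => fderiv ℝ (σ i).u) (fun i => measurable_fderiv ℝ _) a r ha' hr1 hgrad
  obtain ⟨R, hR⟩ := (h𝒞.isBounded Ω hΩ).subset_closedBall (0 : E n)
  -- Differences of stages vanish outside `Ω`, so Poincaré's inequality transfers the geometric
  -- decay from the gradients to the maps.
  obtain ⟨u, hum, hut, -⟩ := exists_limit_of_geometric (μ := volume)
    (fun i => (σ i).u) (fun i => (σ i).continuous.measurable) (ENNReal.ofReal R * a) r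
    (ENNReal.mul_ne_top ENNReal.ofReal_ne_top ha') hr1 (fun i => by
      refine (Stage.lintegral_sub_le hn h𝒞 hΩ hM (σ i) (σ (i + 1)) hR).trans ?_
      rw [mul_assoc]
      gcongr
      exact hgrad i)
  refine ⟨u, Du, hasWeakGradient_of_limit hn h𝒞 hΩ hM σ hum hDum hut hDut, hDum, ?_, ?_, ?_⟩
  · have hsum : ∑' i, (σ i).depthVolume q ≠ ⊤ := by
      refine ne_top_of_le_ne_top ?_ (ENNReal.tsum_le_tsum hV)
      rw [ENNReal.tsum_mul_left, ENNReal.tsum_geometric]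
      exact ENNReal.mul_ne_top hV0 (ENNReal.inv_ne_top.2 (tsub_pos_of_lt hr1).ne')
    rw [ae_restrict_iff' hΩm]
    filter_upwards [ae_limit_mem h𝒞 hΩ hM σ hq (fun i => (hσ i).parent) hsum K hK, hDut]
      with x hx1 hx2 hx3
    exact hx1 hx3 _ hx2
  · rw [ae_restrict_iff' hΩm.compl]
    filter_upwards [ae_all_iff.2 fun i => (σ i).ae_fderiv h𝒞 hΩ hM, hDut] with x hx1 hx2 hx3
    refine tendsto_nhds_unique hx2 ?_
    simp only [(hx1 _).1 hx3]
    exact tendsto_const_nhds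
  · set C₁ : ℝ≥0∞ := a * (1 - r)⁻¹ with hC₁
    have hC₁t : C₁ ≠ ⊤ := ENNReal.mul_ne_top ha' (ENNReal.inv_ne_top.2 (tsub_pos_of_lt hr1).ne')
    refine ⟨max C₁.toReal (s₀.weightedPerimeter wt).toReal, by positivity, fun i => ⟨σ i, ?_, ?_⟩⟩
    · refine (hDui i).trans ?_
      calc a * r ^ i * (1 - r)⁻¹ = C₁ * r ^ i := by rw [hC₁]; ring
        _ = ENNReal.ofReal (C₁.toReal * ρ ^ i) := by
            rw [ENNReal.ofReal_mul ENNReal.toReal_nonneg, ENNReal.ofReal_toReal hC₁t,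
              ENNReal.ofReal_pow hρ0]
        _ ≤ _ := by
            refine ENNReal.ofReal_le_ofReal ?_
            gcongr
            exact le_max_left _ _
    -- All weights are at least `1`, so the weighted perimeter dominates the true one; the initial
    -- weight only enters the constant.
    · calc ∑ c : (σ i).ι, perimeter ((σ i).P c) ≤ (σ i).weightedPerimeter wt := by
            refine Finset.sum_le_sum fun c _ => ?_
            exact le_mul_of_one_le_left zero_le (hwt _ _ _)
        _ ≤ s₀.weightedPerimeter wt * ENNReal.ofReal Λ ^ i := hP i
        _ = ENNReal.ofReal ((s₀.weightedPerimeter wt).toReal * Λ ^ i) := by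
            rw [ENNReal.ofReal_mul ENNReal.toReal_nonneg, ENNReal.ofReal_toReal hP0,
              ENNReal.ofReal_pow hΛ]
        _ ≤ _ := by
            refine ENNReal.ofReal_le_ofReal ?_
            gcongr
            exact le_max_right _ _

/-! ### Regularity of functions of the gradient -/

/-- The approximations are `F` of the gradients of the stages. Continuity of `F` is not needed: the
limit gradient lies in `K`, so one-sided Lipschitz control at `K` gives the `L¹` error, and
boundedness of `F` times the perimeters gives the variation. -/
lemma memFracSobolev_comp (hn : 0 < n) (h𝒞 : IsDomainClass 𝒞) (hΩ : Ω ∈ 𝒞) (hM : ‖M₀‖ ≤ L)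
    {K : Set (Mat n)} {Du : E n → Mat n} (hDum : Measurable Du)
    (hDuK : ∀ᵐ x ∂(volume.restrict Ω), Du x ∈ K) {ρ Λ C : ℝ} (hρ : 0 < ρ) (hρ1 : ρ < 1)
    (hΛ : 1 < Λ) (hC : 0 ≤ C)
    (happ : ∀ i : ℕ, ∃ s : Stage 𝒞 S Ω M₀ L,
        ∫⁻ x, ‖fderiv ℝ s.u x - Du x‖ₑ ≤ ENNReal.ofReal (C * ρ ^ i) ∧
        ∑ c, perimeter (s.P c) ≤ ENNReal.ofReal (C * Λ ^ i))
    {F : Mat n → ℝ} (hF : Measurable F) {b κ : ℝ} (hb : ∀ A, |F A| ≤ b) (hκ : 0 ≤ κ)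
    (hFK : ∀ A, ∀ B ∈ K, |F A - F B| ≤ κ * ‖A - B‖) {s p : ℝ} (hs : 0 < s) (hp : 1 < p)
    (hsp : s * p < Real.log ρ / (Real.log ρ - Real.log Λ)) :
    MemFracSobolev s p Ω fun x => F (Du x) := by
  have hΩm : MeasurableSet Ω := (h𝒞.isOpen Ω hΩ).measurableSet
  have hb0 : 0 ≤ b := (abs_nonneg _).trans (hb 0)
  refine memFracSobolev_of_approx hn hΩm (h𝒞.isBounded Ω hΩ) (hF.comp hDum) (fun x => hb _)
    (C := κ * C + 2 * b * C) hρ hρ1 hΛ (by positivity) (fun i => ?_) hs hp hsp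
  obtain ⟨t, ht1, ht2⟩ := happ i
  have hm : ∀ c, MeasurableSet (t.P c) := fun c => (h𝒞.isOpen _ (t.mem_class c)).measurableSet
  let g : E n → ℝ := fun x => ∑ c, (t.P c).indicator (fun _ => F (t.A c)) x
  refine ⟨g, Finset.measurable_fun_sum _ fun c _ => measurable_const.indicator (hm c), ?_,
    fun h => ?_⟩
  · have hle : ∀ᵐ x ∂(volume.restrict Ω), ‖F (Du x) - g x‖ₑ ≤
        ENNReal.ofReal κ * ‖fderiv ℝ t.u x - Du x‖ₑ := by
      filter_upwards [hDuK, ae_restrict_of_ae (t.ae_fderiv h𝒞 hΩ hM), ae_restrict_mem hΩm]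
        with x hx1 hx2 hx3
      obtain ⟨c, hc⟩ := hx2.2.2 hx3
      have hg : g x = F (t.A c) := by
        simp only [g]
        rw [Finset.sum_eq_single c]
        · exact indicator_of_mem hc _
        · intro c' _ hcc
          exact indicator_of_notMem (fun h => (t.disjoint c' c hcc).le_bot ⟨h, hc⟩) _
        · simp
      rw [hg, hx2.2.1 c hc, ← ofReal_norm, ← ofReal_norm, ← ENNReal.ofReal_mul hκ,
        Real.norm_eq_abs, abs_sub_comm]
      exact ENNReal.ofReal_le_ofReal (hFK _ _ hx1)
    calc ∫⁻ x in Ω, ‖F (Du x) - g x‖ₑ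
        ≤ ∫⁻ x in Ω, ENNReal.ofReal κ * ‖fderiv ℝ t.u x - Du x‖ₑ := lintegral_mono_ae hle
      _ ≤ ∫⁻ x, ENNReal.ofReal κ * ‖fderiv ℝ t.u x - Du x‖ₑ := setLIntegral_le_lintegral _ _
      _ = ENNReal.ofReal κ * ∫⁻ x, ‖fderiv ℝ t.u x - Du x‖ₑ :=
          lintegral_const_mul _ ((measurable_fderiv ℝ t.u).sub hDum).enorm
      _ ≤ ENNReal.ofReal κ * ENNReal.ofReal (C * ρ ^ i) := by gcongr
      _ ≤ _ := by
          rw [← ENNReal.ofReal_mul hκ]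
          refine ENNReal.ofReal_le_ofReal ?_
          rw [← mul_assoc]
          gcongr
          have : 0 ≤ 2 * b * C := by positivity
          linarith
  · have hpt : ∀ x, ‖g (x + h) - g x‖ₑ ≤ ∑ c, ‖(t.P c).indicator (fun _ => F (t.A c)) (x + h) -
        (t.P c).indicator (fun _ => F (t.A c)) x‖ₑ := by
      intro x
      simp only [g]
      rw [← Finset.sum_sub_distrib]
      exact enorm_sum_le _ _
    calc ∫⁻ x, ‖g (x + h) - g x‖ₑ
        ≤ ∫⁻ x, ∑ c, ‖(t.P c).indicator (fun _ => F (t.A c)) (x + h) -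
            (t.P c).indicator (fun _ => F (t.A c)) x‖ₑ := lintegral_mono hpt
      _ = ∑ c, ∫⁻ x, ‖(t.P c).indicator (fun _ => F (t.A c)) (x + h) -
            (t.P c).indicator (fun _ => F (t.A c)) x‖ₑ := by
          refine lintegral_finsetSum _ fun c _ => ?_
          have hi : Measurable ((t.P c).indicator fun _ => F (t.A c)) :=
            measurable_const.indicator (hm c)
          exact ((hi.comp (measurable_add_const h)).sub hi).enorm
      _ ≤ ∑ c, ENNReal.ofReal b * (2 * ENNReal.ofReal ‖h‖ * perimeter (t.P c)) := by
          refine Finset.sum_le_sum fun c _ => ?_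
          refine (lintegral_indicator_translate_le (t.P c) (hm c)
            (h𝒞.isBounded _ (t.mem_class c)).measure_lt_top.ne
            (h𝒞.perimeter_lt_top _ (t.mem_class c)).ne _ h).trans ?_
          gcongr
          rw [← ofReal_norm]
          exact ENNReal.ofReal_le_ofReal (hb _)
      _ = ENNReal.ofReal b * (2 * ENNReal.ofReal ‖h‖ * ∑ c, perimeter (t.P c)) := by
          rw [Finset.mul_sum, Finset.mul_sum]
      _ ≤ ENNReal.ofReal b * (2 * ENNReal.ofReal ‖h‖ * ENNReal.ofReal (C * Λ ^ i)) := by gcongr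
      _ = ENNReal.ofReal (2 * b * C * ‖h‖ * Λ ^ i) := by
          have e : 2 * b * C * ‖h‖ * Λ ^ i = b * (2 * ‖h‖ * (C * Λ ^ i)) := by ring
          rw [e, ENNReal.ofReal_mul hb0, ENNReal.ofReal_mul (p := 2 * ‖h‖) (by positivity),
            ENNReal.ofReal_mul (p := 2) (by norm_num), ENNReal.ofReal_ofNat]
      _ ≤ _ := by
          refine ENNReal.ofReal_le_ofReal ?_
          have hΛ0 : 0 ≤ Λ := by linarith
          gcongr
          have : 0 ≤ κ * C := by positivity
          linarith

/-! ### Phases -/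

open Classical in
/-- `1` if the matrix is strictly closer to the set `O j` than to the others, and `0` otherwise. -/
def phaseOf (O : Fin m → Set (Mat n)) (j : Fin m) (A : Mat n) : ℝ :=
  if Metric.infEDist A (O j) < Metric.infEDist A (⋃ i ∈ {i | i ≠ j}, O i) then 1 else 0

lemma measurable_phaseOf (O : Fin m → Set (Mat n)) (j : Fin m) : Measurable (phaseOf O j) :=
  Measurable.ite (measurableSet_lt Metric.continuous_infEDist.measurable
    Metric.continuous_infEDist.measurable) measurable_const measurable_const

lemma phaseOf_mem (O : Fin m → Set (Mat n)) (j : Fin m) (A : Mat n) :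
    0 ≤ phaseOf O j A ∧ phaseOf O j A ≤ 1 := by
  unfold phaseOf
  split_ifs <;> simp

/-- A matrix within `c₁/2` of one orbit is at least `c₁/2` away from all the others, by the triangle
inequality. -/
lemma phaseOf_eq {O : Fin m → Set (Mat n)} {c₁ : ℝ}
    (hO : ∀ i j, i ≠ j → ∀ A ∈ O i, ∀ B ∈ O j, c₁ ≤ dist A B) {l : Fin m} {A B : Mat n}
    (hB : B ∈ O l) (hAB : dist A B < c₁ / 2) (j : Fin m) :
    phaseOf O j A = if j = l then 1 else 0 := by
  have hc : 0 < c₁ / 2 := dist_nonneg.trans_lt hAB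
  have h1 : Metric.infEDist A (O l) < ENNReal.ofReal (c₁ / 2) := by
    refine (Metric.infEDist_le_edist_of_mem hB).trans_lt ?_
    rw [edist_dist]
    exact (ENNReal.ofReal_lt_ofReal_iff hc).2 hAB
  have h2 : ∀ i, i ≠ l → ∀ Z ∈ O i, ENNReal.ofReal (c₁ / 2) ≤ edist A Z := by
    intro i hi Z hZ
    rw [edist_dist]
    refine ENNReal.ofReal_le_ofReal ?_
    have := hO i l hi Z hZ B hB
    have := dist_triangle Z A B
    rw [dist_comm Z A] at this
    linarith
  unfold phaseOf
  by_cases hjl : j = l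
  · subst hjl
    rw [if_pos rfl, if_pos]
    refine h1.trans_le (Metric.le_infEDist.2 fun Z hZ => ?_)
    obtain ⟨i, hi, hZi⟩ := mem_iUnion₂.1 hZ
    exact h2 i hi Z hZi
  · rw [if_neg hjl, if_neg]
    rw [not_lt]
    calc Metric.infEDist A (⋃ i ∈ {i | i ≠ j}, O i) ≤ Metric.infEDist A (O l) :=
          Metric.infEDist_anti (subset_biUnion_of_mem (u := O) (Ne.symm hjl : l ≠ j))
      _ ≤ ENNReal.ofReal (c₁ / 2) := h1.le
      _ ≤ Metric.infEDist A (O j) := Metric.le_infEDist.2 fun Z hZ => h2 j hjl Z hZ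

/-- Closer than `c₁/2` to `B` the phase is that of `B`; farther away the trivial bound `1` is at
most `2/c₁` times the distance. -/
lemma abs_phaseOf_sub_le {O : Fin m → Set (Mat n)} {c₁ : ℝ} (hc₁ : 0 < c₁)
    (hO : ∀ i j, i ≠ j → ∀ A ∈ O i, ∀ B ∈ O j, c₁ ≤ dist A B) (j : Fin m) (A : Mat n) {B : Mat n}
    (hB : B ∈ ⋃ l, O l) : |phaseOf O j A - phaseOf O j B| ≤ 2 / c₁ * ‖A - B‖ := by
  obtain ⟨l, hl⟩ := mem_iUnion.1 hB
  rw [← dist_eq_norm]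
  by_cases h : dist A B < c₁ / 2
  · rw [phaseOf_eq hO hl h, phaseOf_eq hO hl (by simpa using hc₁), sub_self, abs_zero]
    positivity
  · have h1 := phaseOf_mem O j A
    have h2 := phaseOf_mem O j B
    calc |phaseOf O j A - phaseOf O j B| ≤ 1 := abs_le.2 ⟨by linarith, by linarith⟩
      _ = 2 / c₁ * (c₁ / 2) := by field_simp
      _ ≤ _ := by gcongr; exact not_lt.1 h

/-- The value of the phase characteristic functions as a function of the gradient. -/
def charOf (O : Fin m → Set (Mat n)) (j : Fin m) (A : Mat n) : ℝ :=
  if (j : ℕ) + 1 < m then phaseOf O j A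
  else 1 - ∑ i ∈ Finset.univ.filter (fun i : Fin m => (i : ℕ) + 1 < m), phaseOf O i A

lemma measurable_charOf (O : Fin m → Set (Mat n)) (j : Fin m) : Measurable (charOf O j) := by
  unfold charOf
  split_ifs
  · exact measurable_phaseOf O j
  · exact measurable_const.sub (Finset.measurable_fun_sum _ fun i _ => measurable_phaseOf O i)

lemma abs_charOf_le (O : Fin m → Set (Mat n)) (j : Fin m) (A : Mat n) : |charOf O j A| ≤ 1 + m := by
  have hp : ∀ i, |phaseOf O i A| ≤ 1 := fun i =>
    abs_le.2 ⟨by linarith [(phaseOf_mem O i A).1], (phaseOf_mem O i A).2⟩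
  unfold charOf
  split_ifs
  · exact (hp j).trans (by simp)
  · refine (abs_sub _ _).trans ?_
    rw [abs_one]
    gcongr
    refine (Finset.abs_sum_le_sum_abs _ _).trans ((Finset.sum_le_card_nsmul _ _ 1 fun i _ => hp i).trans ?_)
    rw [nsmul_eq_mul, mul_one]
    exact_mod_cast (Finset.card_le_univ _).trans (by simp)

lemma abs_charOf_sub_le {O : Fin m → Set (Mat n)} {c₁ : ℝ} (hc₁ : 0 < c₁)
    (hO : ∀ i j, i ≠ j → ∀ A ∈ O i, ∀ B ∈ O j, c₁ ≤ dist A B) (j : Fin m) (A : Mat n) {B : Mat n}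
    (hB : B ∈ ⋃ l, O l) : |charOf O j A - charOf O j B| ≤ (m + 1) * (2 / c₁) * ‖A - B‖ := by
  have hp : ∀ i, |phaseOf O i A - phaseOf O i B| ≤ 2 / c₁ * ‖A - B‖ := fun i =>
    abs_phaseOf_sub_le hc₁ hO i A hB
  have h0 : 0 ≤ 2 / c₁ * ‖A - B‖ := by positivity
  have hm0 : (0 : ℝ) ≤ m := m.cast_nonneg
  unfold charOf
  split_ifs
  · refine (hp j).trans ?_
    rw [mul_assoc]
    nlinarith
  · rw [sub_sub_sub_cancel_left, abs_sub_comm, ← Finset.sum_sub_distrib]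
    refine (Finset.abs_sum_le_sum_abs _ _).trans
      ((Finset.sum_le_card_nsmul _ _ _ fun i _ => hp i).trans ?_)
    rw [nsmul_eq_mul, mul_assoc]
    gcongr
    have : (Finset.univ.filter (fun i : Fin m => (i : ℕ) + 1 < m)).card ≤ m :=
      (Finset.card_le_univ _).trans (by simp)
    have : ((Finset.univ.filter (fun i : Fin m => (i : ℕ) + 1 < m)).card : ℝ) ≤ m := by
      exact_mod_cast this
    linarith

lemma phaseChar_eq_charOf (K G : Set (Mat n)) [Group G] [MulAction G (laminationHull K)]
    (Mw : Fin m → Mat n) (Du : E n → Mat n) (j : Fin m) {x : E n} (hx : x ∈ Ω) :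
    phaseChar K G Mw Ω Du j x = charOf (fun i => groupOrbit K G {Mw i}) j (Du x) := by
  have : ∀ i, phaseIndicator K G Mw Ω Du i x =
      phaseOf (fun i => groupOrbit K G {Mw i}) i (Du x) := fun i => by
    simp [phaseIndicator, phaseOf, hx]
  simp only [phaseChar, charOf, this]

lemma MemFracSobolev.congr {s p : ℝ} (hΩ : MeasurableSet Ω) {f g : E n → ℝ}
    (hf : MemFracSobolev s p Ω f) (h : ∀ x ∈ Ω, g x = f x) : MemFracSobolev s p Ω g := by
  refine ⟨hf.1.ae_eq ?_, lt_of_le_of_lt (le_of_eq ?_) hf.2⟩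
  · exact (ae_restrict_mem hΩ).mono fun x hx => (h x hx).symm
  · refine setLIntegral_congr_fun hΩ fun x hx => setLIntegral_congr_fun hΩ fun y hy => ?_
    simp only [h x hx, h y hy]

/-! ### The step rule from the replacement constructions -/

section StageSeq

variable {V K G : Set (Mat n)} [Group G] [MulAction G (laminationHull K)]
  {Ut U : ℕ → ℕ → Set (Mat n)}

/-- Only `j = m` needs an argument: there the sequence already reads `U_{k+1}^0`, which is `U_k^m =
Ũ_k^m`. -/
lemma stageSeq_of_le (h : AssumptionA2 m V K G Ut U) (hm : 0 < m) (k : ℕ) {j : ℕ} (hj : j ≤ m) :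
    stageSeq m Ut U k j = Ut k j := by
  rcases hj.lt_or_eq with h1 | rfl
  · simp [stageSeq, h1]
  · simp [stageSeq, Nat.div_self hm, h.Ut_last, h.U_last]

lemma stageSeq_of_ge (k : ℕ) {d : ℕ} (hd : m ≤ d) :
    stageSeq m Ut U k d = U (k + d / m) (d % m) := by
  simp [stageSeq, not_lt.2 hd]

/-- At the end of a block the successor is the first set of the next block, which coincides with the
last set of the current one. So the target always has the form required by the replacement
constructions. -/
lemma stageSeq_succ_of_ge (h : AssumptionA2 m V K G Ut U) (hm : 0 < m) (k : ℕ) {d : ℕ}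
    (hd : m ≤ d) : stageSeq m Ut U k (d + 1) = U (k + d / m) (d % m + 1) := by
  rw [stageSeq_of_ge k (hd.trans d.le_succ)]
  have hlt := Nat.mod_lt d hm
  have e := Nat.div_add_mod d m
  by_cases hb : d % m + 1 < m
  · have e1 : d + 1 = m * (d / m) + (d % m + 1) := by omega
    have e2 : (d + 1) / m = d / m := by
      rw [e1, Nat.mul_add_div hm, Nat.div_eq_of_lt hb, add_zero]
    have e3 : (d + 1) % m = d % m + 1 := by
      rw [e1, Nat.mul_add_mod, Nat.mod_eq_of_lt hb]
    rw [e2, e3]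
  · have hb' : d % m + 1 = m := by omega
    have e1 : d + 1 = m * (d / m + 1) := by rw [mul_add, mul_one]; omega
    have e2 : (d + 1) / m = d / m + 1 := by rw [e1, Nat.mul_div_cancel_left _ hm]
    have e3 : (d + 1) % m = 0 := by rw [e1, Nat.mul_mod_right]
    rw [e2, e3, hb', h.U_last, add_assoc]

end StageSeq

/-! ### Perimeter weights that absorb the constants `C₀(j,k)` -/

open Classical in
/-- The weights of the perimeters: large in the first `m` depths, and larger outside of the special
classes. -/
def stepWeight (m : ℕ) (𝒮 : ℕ → Mat n → Set (Set (E n))) (a : ℝ≥0∞) (d : ℕ) (M : Mat n)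
    (D : Set (E n)) : ℝ≥0∞ :=
  if d < m then (if D ∈ 𝒮 d M then a ^ (2 * (m - d)) else a ^ (2 * (m - d) + 1)) else 1

lemma one_le_stepWeight (𝒮 : ℕ → Mat n → Set (Set (E n))) {a : ℝ≥0∞} (ha : 1 ≤ a) (d : ℕ)
    (M : Mat n) (D : Set (E n)) : 1 ≤ stepWeight m 𝒮 a d M D := by
  unfold stepWeight
  split_ifs
  · exact one_le_pow₀ ha
  · exact one_le_pow₀ ha
  · exact le_rfl

lemma stepWeight_ne_top (𝒮 : ℕ → Mat n → Set (Set (E n))) {a : ℝ≥0∞} (ha : a ≠ ⊤) (d : ℕ)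
    (M : Mat n) (D : Set (E n)) : stepWeight m 𝒮 a d M D ≠ ⊤ := by
  unfold stepWeight
  split_ifs
  · exact ENNReal.pow_ne_top ha
  · exact ENNReal.pow_ne_top ha
  · exact ENNReal.one_ne_top

lemma stepWeight_le (𝒮 : ℕ → Mat n → Set (Set (E n))) {a : ℝ≥0∞} (ha : 1 ≤ a) (d : ℕ)
    (M : Mat n) (D : Set (E n)) : stepWeight m 𝒮 a d M D ≤ a ^ (2 * (m - d) + 1) := by
  unfold stepWeight
  split_ifs
  · exact pow_le_pow_right₀ ha (Nat.le_succ _)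
  · exact le_rfl
  · exact one_le_pow₀ ha

/-- The weighted perimeter grows by a uniform factor under replacement constructions
with special classes of domains. -/
lemma sum_stepWeight_le {v₁ C₃ C₂ c : ℝ} (hC₂ : 1 ≤ C₂) {D : Set (E n)} {M : Mat n}
    {T : Set (Mat n)} (R : Replacement 𝒞 v₁ C₃ D M T) (𝒮 : ℕ → Mat n → Set (Set (E n)))
    {a : ℝ≥0∞} (ha : 1 ≤ a) (hca : ENNReal.ofReal c ≤ a) {d : ℕ} (hd : d < m)
    (hgood : ∑ i ∈ R.g, perimeter (R.P i) ≤ ENNReal.ofReal c * perimeter D)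
    (hspecial : D ∈ 𝒮 d M → (∀ i ∉ R.g, R.P i ∈ 𝒮 d M) ∧
      ∑ i ∈ R.gᶜ, perimeter (R.P i) ≤ ENNReal.ofReal C₂ * perimeter D)
    (hother : D ∉ 𝒮 d M → ∃ I₁ I₂ : Finset (Fin R.N), Disjoint I₁ I₂ ∧ I₁ ∪ I₂ = R.gᶜ ∧
      (∀ i ∈ I₁, R.P i ∈ 𝒮 d M) ∧
      ∑ i ∈ I₁, perimeter (R.P i) ≤ ENNReal.ofReal c * perimeter D ∧
      ∑ i ∈ I₂, perimeter (R.P i) ≤ ENNReal.ofReal C₂ * perimeter D) :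
    ∑ i, (if i ∈ R.g then stepWeight m 𝒮 a (d + 1) (R.A i) (R.P i)
        else stepWeight m 𝒮 a d M (R.P i)) * perimeter (R.P i) ≤
      ENNReal.ofReal (C₂ + 2) * (stepWeight m 𝒮 a d M D * perimeter D) := by
  classical
  have hsplit : ∑ i, (if i ∈ R.g then stepWeight m 𝒮 a (d + 1) (R.A i) (R.P i)
        else stepWeight m 𝒮 a d M (R.P i)) * perimeter (R.P i) =
      ∑ i ∈ R.g, stepWeight m 𝒮 a (d + 1) (R.A i) (R.P i) * perimeter (R.P i) +
      ∑ i ∈ R.gᶜ, stepWeight m 𝒮 a d M (R.P i) * perimeter (R.P i) := by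
    rw [← Finset.sum_add_sum_compl R.g]
    congr 1
    · exact Finset.sum_congr rfl fun i hi => by rw [if_pos hi]
    · exact Finset.sum_congr rfl fun i hi => by rw [if_neg (Finset.mem_compl.1 hi)]
  set X : ℝ≥0∞ := a ^ (2 * (m - d)) with hX
  have hX1 : a ^ (2 * (m - d) + 1) = X * a := pow_succ _ _
  -- Good pieces carry a new matrix, so nothing is known about their special class and the worst
  -- weight at depth `d + 1` is used. Its exponent `2(m-d-1) + 1` leaves exactly one factor `a` to
  -- absorb `c`.
  have hg : ∑ i ∈ R.g, stepWeight m 𝒮 a (d + 1) (R.A i) (R.P i) * perimeter (R.P i) ≤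
      X * perimeter D := by
    calc ∑ i ∈ R.g, stepWeight m 𝒮 a (d + 1) (R.A i) (R.P i) * perimeter (R.P i)
        ≤ ∑ i ∈ R.g, a ^ (2 * (m - (d + 1)) + 1) * perimeter (R.P i) :=
          Finset.sum_le_sum fun i _ => by gcongr; exact stepWeight_le 𝒮 ha _ _ _
      _ = a ^ (2 * (m - (d + 1)) + 1) * ∑ i ∈ R.g, perimeter (R.P i) := (Finset.mul_sum _ _ _).symm
      _ ≤ a ^ (2 * (m - (d + 1)) + 1) * (a * perimeter D) := by
          gcongr
          exact hgood.trans (by gcongr)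
      _ = X * perimeter D := by
          rw [← mul_assoc, ← pow_succ, hX]
          congr 2
          omega
  have hsum : ENNReal.ofReal (C₂ + 2) = 1 + 1 + ENNReal.ofReal C₂ := by
    rw [ENNReal.ofReal_add (by linarith) (by norm_num), ENNReal.ofReal_ofNat, add_comm,
      one_add_one_eq_two]
  rw [hsplit, hsum, add_mul, add_mul, one_mul]
  by_cases hD : D ∈ 𝒮 d M
  · obtain ⟨hb1, hb2⟩ := hspecial hD
    have hw : stepWeight m 𝒮 a d M D = X := by simp [stepWeight, hd, hD, hX]
    rw [hw]
    have hb : ∑ i ∈ R.gᶜ, stepWeight m 𝒮 a d M (R.P i) * perimeter (R.P i) ≤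
        ENNReal.ofReal C₂ * (X * perimeter D) := by
      calc ∑ i ∈ R.gᶜ, stepWeight m 𝒮 a d M (R.P i) * perimeter (R.P i)
          = ∑ i ∈ R.gᶜ, X * perimeter (R.P i) := Finset.sum_congr rfl fun i hi => by
            simp [stepWeight, hd, hb1 i (Finset.mem_compl.1 hi), hX]
        _ = X * ∑ i ∈ R.gᶜ, perimeter (R.P i) := (Finset.mul_sum _ _ _).symm
        _ ≤ X * (ENNReal.ofReal C₂ * perimeter D) := by gcongr
        _ = _ := by ring
    exact add_le_add (hg.trans le_self_add) hb
  · obtain ⟨I₁, I₂, hdis, hun, h1, h2, h3⟩ := hother hD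
    have hw : stepWeight m 𝒮 a d M D = X * a := by
      rw [← hX1]; simp [stepWeight, hd, hD]
    rw [hw, ← hun, Finset.sum_union hdis, ← add_assoc]
    -- Bad pieces keep `M`, hence also the special class. Entering that class lowers the weight by
    -- `a`, which pays for the factor `c`.
    have hb1 : ∑ i ∈ I₁, stepWeight m 𝒮 a d M (R.P i) * perimeter (R.P i) ≤
        X * a * perimeter D := by
      calc ∑ i ∈ I₁, stepWeight m 𝒮 a d M (R.P i) * perimeter (R.P i)
          = ∑ i ∈ I₁, X * perimeter (R.P i) := Finset.sum_congr rfl fun i hi => by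
            simp [stepWeight, hd, h1 i hi, hX]
        _ = X * ∑ i ∈ I₁, perimeter (R.P i) := (Finset.mul_sum _ _ _).symm
        _ ≤ X * (a * perimeter D) := by
            gcongr
            exact h2.trans (by gcongr)
        _ = _ := by ring
    have hb2 : ∑ i ∈ I₂, stepWeight m 𝒮 a d M (R.P i) * perimeter (R.P i) ≤
        ENNReal.ofReal C₂ * (X * a * perimeter D) := by
      calc ∑ i ∈ I₂, stepWeight m 𝒮 a d M (R.P i) * perimeter (R.P i)
          ≤ ∑ i ∈ I₂, X * a * perimeter (R.P i) := Finset.sum_le_sum fun i _ => by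
            gcongr
            exact hX1 ▸ stepWeight_le 𝒮 ha d M _
        _ = X * a * ∑ i ∈ I₂, perimeter (R.P i) := (Finset.mul_sum _ _ _).symm
        _ ≤ X * a * (ENNReal.ofReal C₂ * perimeter D) := by gcongr
        _ = _ := by ring
    refine add_le_add (add_le_add (hg.trans ?_) hb1) hb2
    gcongr
    exact le_mul_of_one_le_right zero_le ha

/-! ### Change of the gradient in one step -/

lemma Replacement.sum_volume_le {v₁ C₃ : ℝ} {D : Set (E n)} {M : Mat n} {T : Set (Mat n)}
    (h𝒞 : IsDomainClass 𝒞) (R : Replacement 𝒞 v₁ C₃ D M T) (I : Finset (Fin R.N)) :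
    ∑ i ∈ I, volume (R.P i) = volume (⋃ i ∈ I, R.P i) ∧ ∑ i ∈ I, volume (R.P i) ≤ volume D := by
  have e : ∑ i ∈ I, volume (R.P i) = volume (⋃ i ∈ I, R.P i) :=
    (measure_biUnion_finset (fun i _ j _ hij => R.disjoint i j hij)
      (fun i _ => (h𝒞.isOpen _ (R.mem_class i)).measurableSet)).symm
  exact ⟨e, e ▸ measure_mono (iUnion₂_subset fun i _ => R.subset i)⟩

lemma Replacement.enorm_sub_le {v₁ C₃ : ℝ} {D : Set (E n)} {M : Mat n} {T : Set (Mat n)}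
    (R : Replacement 𝒞 v₁ C₃ D M T) (hM : ‖M‖ ≤ L) (hC₃ : C₃ ≤ L) (i : Fin R.N) :
    ‖R.A i - M‖ₑ ≤ ENNReal.ofReal (2 * L) := by
  rw [← ofReal_norm]
  refine ENNReal.ofReal_le_ofReal ((norm_sub_le _ _).trans ?_)
  linarith [R.bounded i]

/-- If the gradient is `ε`-close to `M` on most of the good pieces, then it is close to `M` in
`L¹`. -/
lemma Replacement.sum_enorm_sub_le {v₁ C₃ ε : ℝ} {D : Set (E n)} {M : Mat n} {T : Set (Mat n)}
    (h𝒞 : IsDomainClass 𝒞) (hD : D ∈ 𝒞) (R : Replacement 𝒞 v₁ C₃ D M T) (hM : ‖M‖ ≤ L)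
    (hC₃ : C₃ ≤ L) (hε : 0 ≤ ε) {Dstar : Set (E n)} (hsub : Dstar ⊆ ⋃ i ∈ R.g, R.P i)
    (hvol : ENNReal.ofReal (1 - ε) * volume (⋃ i ∈ R.g, R.P i) ≤ volume Dstar)
    (hclose : ∀ i, ∀ x ∈ Dstar ∩ R.P i, ‖R.A i - M‖ ≤ ε) :
    ∑ i ∈ R.g, ‖R.A i - M‖ₑ * volume (R.P i) ≤ ENNReal.ofReal (ε * (1 + 2 * L)) * volume D := by
  classical
  -- The gradient is constant on pieces, so a good piece meeting `Dstar` is `ε`-close to `M` as a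
  -- whole. The remaining pieces `J` fill at most the fraction `ε`.
  let I := R.g.filter fun i => ‖R.A i - M‖ ≤ ε
  let J := R.g.filter fun i => ¬ ‖R.A i - M‖ ≤ ε
  have hDfin : volume D ≠ ⊤ := (h𝒞.isBounded D hD).measure_lt_top.ne
  have hIJ : ∑ i ∈ I, volume (R.P i) + ∑ i ∈ J, volume (R.P i) = ∑ i ∈ R.g, volume (R.P i) :=
    Finset.sum_filter_add_sum_filter_not _ _ _
  have hIv : ENNReal.ofReal (1 - ε) * ∑ i ∈ R.g, volume (R.P i) ≤ ∑ i ∈ I, volume (R.P i) := by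
    rw [(R.sum_volume_le h𝒞 _).1, (R.sum_volume_le h𝒞 _).1]
    refine hvol.trans (measure_mono fun x hx => ?_)
    obtain ⟨i, hi, hxi⟩ := mem_iUnion₂.1 (hsub hx)
    exact mem_iUnion₂.2 ⟨i, Finset.mem_filter.2 ⟨hi, hclose i x ⟨hx, hxi⟩⟩, hxi⟩
  have hgfin : ∑ i ∈ R.g, volume (R.P i) ≠ ⊤ := ne_top_of_le_ne_top hDfin (R.sum_volume_le h𝒞 _).2
  have hIfin : ∑ i ∈ I, volume (R.P i) ≠ ⊤ := ne_top_of_le_ne_top hDfin (R.sum_volume_le h𝒞 _).2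
  have hJv : ∑ i ∈ J, volume (R.P i) ≤ ENNReal.ofReal ε * ∑ i ∈ R.g, volume (R.P i) := by
    -- This form remains valid for `ε > 1`, when `ENNReal.ofReal (1 - ε)` is `0`.
    have h1 : ∑ i ∈ R.g, volume (R.P i) ≤ ENNReal.ofReal (1 - ε) * ∑ i ∈ R.g, volume (R.P i) +
        ENNReal.ofReal ε * ∑ i ∈ R.g, volume (R.P i) := by
      rw [← add_mul]
      refine le_mul_of_one_le_left zero_le ?_
      rw [← ENNReal.ofReal_one]
      refine le_trans (le_of_eq ?_) (ENNReal.ofReal_add_le (p := 1 - ε) (q := ε))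
      rw [sub_add_cancel]
    have h2 : ∑ i ∈ I, volume (R.P i) + ∑ i ∈ J, volume (R.P i) ≤
        ∑ i ∈ I, volume (R.P i) + ENNReal.ofReal ε * ∑ i ∈ R.g, volume (R.P i) := by
      rw [hIJ]
      exact h1.trans (by gcongr)
    exact (ENNReal.add_le_add_iff_left hIfin).1 h2
  calc ∑ i ∈ R.g, ‖R.A i - M‖ₑ * volume (R.P i)
      = ∑ i ∈ I, ‖R.A i - M‖ₑ * volume (R.P i) + ∑ i ∈ J, ‖R.A i - M‖ₑ * volume (R.P i) :=
        (Finset.sum_filter_add_sum_filter_not _ _ _).symm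
    _ ≤ ∑ i ∈ I, ENNReal.ofReal ε * volume (R.P i) +
        ∑ i ∈ J, ENNReal.ofReal (2 * L) * volume (R.P i) := by
        refine add_le_add (Finset.sum_le_sum fun i hi => ?_) (Finset.sum_le_sum fun i _ => ?_)
        · gcongr
          rw [← ofReal_norm]
          exact ENNReal.ofReal_le_ofReal (Finset.mem_filter.1 hi).2
        · gcongr
          exact R.enorm_sub_le hM hC₃ i
    _ = ENNReal.ofReal ε * ∑ i ∈ I, volume (R.P i) +
        ENNReal.ofReal (2 * L) * ∑ i ∈ J, volume (R.P i) := by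
        rw [Finset.mul_sum, Finset.mul_sum]
    _ ≤ ENNReal.ofReal ε * volume D + ENNReal.ofReal (2 * L) * (ENNReal.ofReal ε * volume D) := by
        gcongr
        · exact (R.sum_volume_le h𝒞 _).2
        · refine hJv.trans ?_
          gcongr
          exact (R.sum_volume_le h𝒞 _).2
    _ = _ := by
        have hL : (0 : ℝ) ≤ 2 * L := by positivity
        rw [mul_add, mul_one, ENNReal.ofReal_add hε (by positivity), ENNReal.ofReal_mul hε]
        ring

/-- The decay of `c ^ (d / m)` in terms of the `m`-th root of `c`. -/
lemma pow_div_le_root_pow (hm : 0 < m) {q : ℝ} (hq : 0 < q ∧ q < 1) (d : ℕ) :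
    (q ^ m) ^ (d / m) ≤ q ^ d / q ^ m := by
  rw [le_div_iff₀ (pow_pos hq.1 m), ← pow_mul, ← pow_add]
  refine pow_le_pow_of_le_one hq.1.le hq.2.le ?_
  have := Nat.div_add_mod d m
  have := Nat.mod_lt d hm
  omega

/-- Below depth `m` the weights handle the perimeters, and the crude gradient bound `2L` is harmless
since `q ^ d / q ^ m ≥ 1`. From depth `m` on the weights are `1`, and the closeness `C₃ c₂^(k +
d/m)` decays like `q ^ d` up to the factor `q ^ m` in the denominator of `B`. -/
lemma stepRule_of_assumptions (hm : 0 < m) {V K G : Set (Mat n)} [Group G]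
    [MulAction G (laminationHull K)] {Ut U : ℕ → ℕ → Set (Mat n)}
    {𝒞₁ : ℕ → ℕ → Mat n → Set (Set (E n))} {C₀ : ℕ → ℕ → ℝ} {v₁ C₁ C₂ C₃ q : ℝ}
    (hq : 0 < q ∧ q < 1) (hC₂ : 1 ≤ C₂) (hC₃ : 1 < C₃) (hL : C₃ ≤ L)
    (h𝒞 : IsDomainClass 𝒞) (hA2 : AssumptionA2 m V K G Ut U)
    (hA3 : AssumptionA3t m Ut 𝒞 𝒞₁ v₁ C₂ C₃ C₀)
    (hA4 : AssumptionA3A4 m U 𝒞 v₁ C₁ (q ^ m) C₃) (k : ℕ) {a : ℝ≥0∞} (ha : 1 ≤ a)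
    (hCa : ∀ j < m, ENNReal.ofReal (C₀ k j) ≤ a) :
    StepRule 𝒞 (stageSeq m Ut U k) (stepWeight m (𝒞₁ k) a) v₁ C₃ q
      (C₃ * (1 + 2 * L) / q ^ m) (max C₁ (C₂ + 2)) L := by
  intro d D hD M hM hML
  have hqm : 0 < q ^ m := pow_pos hq.1 m
  rcases lt_or_ge d m with hd | hd
  · rw [stageSeq_of_le hA2 hm k hd.le] at hM
    rw [stageSeq_of_le hA2 hm k hd]
    obtain ⟨R, h1, h2, h3⟩ := hA3.construction k d hd D hD M hM
    refine ⟨R, (sum_stepWeight_le hC₂ R (𝒞₁ k) ha (hCa d hd) hd h1 h2 h3).trans ?_, ?_⟩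
    · gcongr
      exact le_max_right _ _
    · calc ∑ i ∈ R.g, ‖R.A i - M‖ₑ * volume (R.P i)
          ≤ ∑ i ∈ R.g, ENNReal.ofReal (2 * L) * volume (R.P i) :=
            Finset.sum_le_sum fun i _ => by gcongr; exact R.enorm_sub_le hML hL i
        _ = ENNReal.ofReal (2 * L) * ∑ i ∈ R.g, volume (R.P i) := (Finset.mul_sum _ _ _).symm
        _ ≤ ENNReal.ofReal (C₃ * (1 + 2 * L) / q ^ m * q ^ d) * volume D := by
            refine mul_le_mul' (ENNReal.ofReal_le_ofReal ?_) (R.sum_volume_le h𝒞 _).2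
            · have h4 : 1 ≤ q ^ d / q ^ m :=
                (one_le_div hqm).2 (pow_le_pow_of_le_one hq.1.le hq.2.le hd.le)
              have hL0 : (0 : ℝ) ≤ L := L.2
              calc (2 * L : ℝ) ≤ 1 * (1 + 2 * L) * 1 := by linarith
                _ ≤ C₃ * (1 + 2 * L) * (q ^ d / q ^ m) := by gcongr
                _ = C₃ * (1 + 2 * L) / q ^ m * q ^ d := by ring
  · rw [stageSeq_of_ge k hd] at hM
    rw [stageSeq_succ_of_ge hA2 hm k hd]
    obtain ⟨R, h1, Dstar, h2, h3, h4⟩ := hA4 (k + d / m) (d % m) (Nat.mod_lt d hm) D hD M hM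
    have hw : ∀ d' M' D', m ≤ d' → stepWeight m (𝒞₁ k) a d' M' D' = 1 := fun d' M' D' h => by
      simp [stepWeight, not_lt.2 h]
    refine ⟨R, ?_, ?_⟩
    · simp only [hw _ _ _ hd, hw _ _ _ (hd.trans d.le_succ), ite_self, one_mul]
      refine h1.trans ?_
      gcongr
      exact le_max_left _ _
    · refine (R.sum_enorm_sub_le h𝒞 hD hML hL (by positivity) h2 h3 h4).trans ?_
      refine mul_le_mul' (ENNReal.ofReal_le_ofReal ?_) le_rfl
      have hdec := pow_div_le_root_pow hm hq d
      have hle : (q ^ m) ^ (k + d / m) ≤ q ^ d / q ^ m := by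
        refine le_trans (pow_le_pow_of_le_one hqm.le (pow_le_one₀ hq.1.le hq.2.le) ?_) hdec
        omega
      have hL0 : (0 : ℝ) ≤ L := L.2
      calc C₃ * (q ^ m) ^ (k + d / m) * (1 + 2 * L)
          ≤ C₃ * (q ^ d / q ^ m) * (1 + 2 * L) := by gcongr
        _ = C₃ * (1 + 2 * L) / q ^ m * q ^ d := by ring

lemma laminationHull_empty : laminationHull (∅ : Set (Mat n)) = ∅ := by
  have h : ∀ l, laminates (∅ : Set (Mat n)) l = ∅ := by
    intro l
    induction l with
    | zero => rfl
    | succ l ih => simp [laminates, ih]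
  simp [laminationHull, h]

lemma AssumptionA1.pos {V K G : Set (Mat n)} [Group G] [MulAction G (laminationHull K)]
    {Mw : Fin m → Mat n} (h : AssumptionA1 V K G Mw) : 0 < m := by
  rcases Nat.eq_zero_or_pos m with rfl | hm
  · exfalso
    have hK : K = ∅ := by rw [h.union]; simp
    obtain ⟨M, -, hM, -⟩ := h.nonempty
    rw [hK, laminationHull_empty] at hM
    exact hM
  · exact hm

end CvxInt

end

/-! ### Choice of the exponent and conclusion -/

theorem mainTheorem3 (n m : ℕ) (hn : 0 < n) (v₁ c₂ C₁ C₂ : ℝ)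
    (hv₁ : 0 < v₁ ∧ v₁ < 1) (hc₂ : 0 < c₂ ∧ c₂ < 1) (hC₁ : 1 ≤ C₁) (hC₂ : 1 ≤ C₂) :
    ∃ θ₀ : ℝ, 0 < θ₀ ∧ θ₀ < 1 ∧
      ∀ (V K G : Set (CvxInt.Mat n)) [Group G] [IsTopologicalGroup G]
        [MulAction G (CvxInt.laminationHull K)] [ContinuousSMul G (CvxInt.laminationHull K)]
        (Mw : Fin m → CvxInt.Mat n)
        (Ut U : ℕ → ℕ → Set (CvxInt.Mat n))
        (𝒞 : Set (Set (CvxInt.E n)))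
        (𝒞₁ : ℕ → ℕ → CvxInt.Mat n → Set (Set (CvxInt.E n)))
        (C₀ : ℕ → ℕ → ℝ) (C₃ : ℝ),
        1 < C₃ →
        CvxInt.IsDomainClass 𝒞 →
        CvxInt.AssumptionA1 V K G Mw →
        CvxInt.AssumptionA2 m V K G Ut U →
        CvxInt.AssumptionA3t m Ut 𝒞 𝒞₁ v₁ C₂ C₃ C₀ →
        CvxInt.AssumptionA3A4 m U 𝒞 v₁ C₁ c₂ C₃ →
        ∀ Ω ∈ 𝒞, ∀ s p : ℝ, 0 < s → s < 1 → 1 < p → s * p < θ₀ →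
        ∀ M₀ ∈ CvxInt.relInterior V (CvxInt.laminationHull K),
        ∃ (u : CvxInt.E n → CvxInt.E n) (Du : CvxInt.E n → CvxInt.Mat n),
          CvxInt.HasWeakGradientW1InftyLoc u Du ∧
          (∀ᵐ x ∂(volume.restrict Ω), Du x ∈ K) ∧
          (∀ᵐ x ∂(volume.restrict Ωᶜ), Du x = M₀) ∧
          ∀ j : Fin m, CvxInt.MemFracSobolev s p Ω (CvxInt.phaseChar K G Mw Ω Du j) := by
  rcases Nat.eq_zero_or_pos m with rfl | hm
  -- For `m = 0` the set `K` would be empty, contradicting (A1); any value in `(0, 1)` serves.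
  · exact ⟨1 / 2, by norm_num, by norm_num, fun V K G _ _ _ _ Mw Ut U 𝒞 𝒞₁ C₀ C₃ _ _ hA1 =>
      absurd hA1.pos (lt_irrefl 0)⟩
  -- One block of `m` depths gains one factor `c₂`, so each single depth is credited with its `m`-th
  -- root.
  set q : ℝ := c₂ ^ ((m : ℝ)⁻¹) with hqdef
  have hq : 0 < q ∧ q < 1 :=
    ⟨Real.rpow_pos_of_pos hc₂.1 _, Real.rpow_lt_one hc₂.1.le hc₂.2 (by positivity)⟩
  have hqm : q ^ m = c₂ := Real.rpow_inv_natCast_pow hc₂.1.le hm.ne'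
  set ρ : ℝ := 1 - v₁ * (1 - q) with hρ
  set Λ : ℝ := max C₁ (C₂ + 2) with hΛdef
  have hρ0 : 0 < ρ := by nlinarith [hv₁.1, hv₁.2, hq.1, hq.2]
  have hρ1 : ρ < 1 := by nlinarith [hv₁.1, hv₁.2, hq.1, hq.2]
  have hΛ : 1 < Λ := lt_of_lt_of_le (by linarith) (le_max_right _ _)
  have hlρ : Real.log ρ < 0 := Real.log_neg hρ0 hρ1
  have hlΛ : 0 < Real.log Λ := Real.log_pos hΛ
  refine ⟨Real.log ρ / (Real.log ρ - Real.log Λ), div_pos_of_neg_of_neg hlρ (by linarith), ?_, ?_⟩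
  · rw [div_lt_one_of_neg (by linarith)]
    linarith
  intro V K G _ _ _ _ Mw Ut U 𝒞 𝒞₁ C₀ C₃ hC₃ h𝒞 hA1 hA2 hA3 hA4 Ω hΩ s p hs hs1 hp hsp M₀ hM₀
  rw [hA2.cover] at hM₀
  obtain ⟨k, hM₀⟩ := mem_iUnion.1 hM₀
  obtain ⟨j₀, hj₀, hM₀⟩ := mem_iUnion₂.1 hM₀
  rw [← CvxInt.stageSeq_of_le hA2 hm k hj₀] at hM₀
  let L : NNReal := Real.toNNReal (max C₃ ‖M₀‖)
  have hL : (L : ℝ) = max C₃ ‖M₀‖ := Real.coe_toNNReal _ (le_max_of_le_right (norm_nonneg _))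
  have hL1 : C₃ ≤ L := hL ▸ le_max_left _ _
  have hL2 : ‖M₀‖ ≤ L := hL ▸ le_max_right _ _
  -- Only the block `k` containing `M₀` uses `C₀`, so finitely many constants are dominated by one
  -- finite `a`. Neither `a` nor `L` enters `ρ` or `Λ`.
  let a : ENNReal := 1 + ∑ j ∈ Finset.range m, ENNReal.ofReal (C₀ k j)
  have ha : 1 ≤ a := le_self_add
  have hat : a ≠ ⊤ := ENNReal.add_ne_top.2 ⟨ENNReal.one_ne_top,
    ENNReal.sum_ne_top.2 fun _ _ => ENNReal.ofReal_ne_top⟩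
  have hCa : ∀ j < m, ENNReal.ofReal (C₀ k j) ≤ a := fun j hj =>
    (Finset.single_le_sum (f := fun j => ENNReal.ofReal (C₀ k j)) (fun _ _ => zero_le)
      (Finset.mem_range.2 hj)).trans le_add_self
  rw [← hqm] at hA4
  have hstep := CvxInt.stepRule_of_assumptions hm hq hC₂ hC₃ hL1 h𝒞 hA2 hA3 hA4 k ha hCa
  have hB : 0 ≤ C₃ * (1 + 2 * L) / q ^ m := by
    have := hq.1
    positivity
  obtain ⟨u, Du, h1, h2, h3, h4, C, hC, h5⟩ := CvxInt.exists_solution_of_stepRule hn hv₁ hq hB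
    (zero_le_one.trans hΛ.le) h𝒞 hΩ hL2 hL1 hstep (CvxInt.one_le_stepWeight _ ha) hM₀
    (CvxInt.stepWeight_ne_top _ hat _ _ _) K (hA2.inApprox k).limit_mem
  refine ⟨u, Du, h1, h3, h4, fun j => ?_⟩
  obtain ⟨c₁, hc₁, hsep⟩ := hA1.separated
  have hunion := hA1.union
  refine (CvxInt.memFracSobolev_comp hn h𝒞 hΩ hL2 h2 h3 hρ0 hρ1 hΛ hC h5
    (CvxInt.measurable_charOf (fun i => CvxInt.groupOrbit K G {Mw i}) j)
    (CvxInt.abs_charOf_le _ j) (κ := (m + 1) * (2 / c₁)) (by positivity)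
    (fun A B hB => CvxInt.abs_charOf_sub_le hc₁ hsep j A (hunion ▸ hB)) hs hp hsp).congr
    (h𝒞.isOpen Ω hΩ).measurableSet fun x hx => ?_
  exact CvxInt.phaseChar_eq_charOf K G Mw Du j hx
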